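/- **Language.** Modal formulas are built from atomic variables, $\top$, $\bot$ by $\wedge,\vee,\to,\square$. An occurrence in a formula is *outer* if it is neither in the scope of an implication nor in the scope of a box; an *outer box* of $A$ is a boxed subformula $\square C$ with an occurrence that is not in the scope of another box. The box-translation $(\cdot)^\square$ is given by $p^\square=p\wedge\square p$ for atomic variables $p$, $\top^\square=\top$, $\bot^\square=\bot$, $(A\circ B)^\square=A^\square\circ B^\square$ for $\circ\in\{\wedge,\vee\}$, $(A\to B)^\square=(A^\square\to B^\square)\wedge\square(A^\square\to B^\square)$, $(\square A)^\square=\square(A^\square)$. **Theories.** $\mathsf{IPC}_\square$ is intuitionistic propositional logic in the modal language. $i\mathsf{K4}$ has as axioms the theorems of $\mathsf{IPC}_\square$, $\square(A\to B)\to(\square A\to\square B)$ and $\square A\to\square\square A$, with the rules modus ponens and necessitation; $i\mathsf{GL}$ is $i\mathsf{K4}$ plus $\square(\square A\to A)\to\square A$; $\mathsf{CP}$ is the schema $A\to\square A$. Let $[A]E:=E$ if $E$ is an atomic variable, $\top$, $\bot$ or boxed, $[A](E_1\circ E_2):=[A]E_1\circ[A]E_2$ for $\circ\in\{\wedge,\vee\}$,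 $[A](E_1\to E_2):=A\to(E_1\to E_2)$, and $[A]Z:=\bigvee_{E\in Z}[A]E$ for finite sets $Z$. Let $\blacktriangleright^*$ be the smallest relation on modal formulas such that - (A1) $A\blacktriangleright^*B$ whenever $i\mathsf{K4}\vdash A\to B$; (A2) $\blacktriangleright^*$ is transitive; (A3) $C\blacktriangleright^*A$ and $C\blacktriangleright^*B$ imply $C\blacktriangleright^*A\wedge B$; (A4) $A\blacktriangleright^*B$ implies $\square A\blacktriangleright^*\square B$; - (B1) $A\blacktriangleright^*C$ and $B\blacktriangleright^*C$ imply $A\vee B\blacktriangleright^*C$; - (B2) if $X$ is a finite set of implications, $B=\bigwedge X$ and $Z=\{E\mid E\to F\in X\}\cup\{C\}$, then $(B\to C)\wedge\square B\blacktriangleright^*[B]Z$; - (B3) $A\blacktriangleright^*B$ implies $(p\to A)\blacktriangleright^*(p\to B)$ for $p$ an atomic variable or boxed. Then $\mathsf{iH}^*_\sigma:=i\mathsf{GL}+\mathsf{CP}+\{\square A\to\square B\mid A\blacktriangleright^*B\}$, closed under modus ponens and necessitation. **Algorithms.** The (nondeterministic) NNIL-algorithm turns a formula $A$ into a formula $A^*$,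 treating boxed formulas as atoms: $A^*=A$ if $A$ is an atomic variable, $\top$, $\bot$ or boxed; $(B\circ C)^*=B^*\circ C^*$ for $\circ\in\{\wedge,\vee\}$; and for $A=B\to C$: - if $C=J[q|D\wedge E]$, where $q$ has exactly one occurrence in $J$ and that occurrence is outer, one may take $A^*=(B\to J[q|D])^*\wedge(B\to J[q|E])^*$; if $B=J[q|D\vee E]$ with $J$ as before, one may take $A^*=(J[q|D]\to C)^*\wedge(J[q|E]\to C)^*$; - otherwise $B=\bigwedge X$ for a finite set $X$ of implications, atomic variables, boxed formulas, $\top$ and $\bot$ (for $B=\top$ take $X=\emptyset$; $\bigwedge\emptyset=\top$). If $p\in X$ is an atomic variable or boxed, one may take $A^*=p\to(\bigwedge(X\setminus\{p\})\to C)^*$; if $\top\in X$, $A^*=(\bigwedge(X\setminus\{\top\})\to C)^*$; if $\bot\in X$, $A^*=\top$. If $X$ contains only implications, then $$A^*=\bigwedge_{(E\to F)\in X}\Bigl(\bigwedge\bigl((X\setminus\{E\to F\})\cup\{F\}\bigr)\to C\Bigr)^*\wedge A_0^*,$$ where, with $Z=\{E\mid E\to F\in X\}\cup\{C\}$, $A_0=[B]Z$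 if $\mathfrak o([B]Z)<\mathfrak o(A)$, and $A_0=[B]'Z$ otherwise. Here $[B]'$ is defined like $[B]$ except that $[B]'(E_1\to E_2)=(B[E_1\to E_2\,|\,E_2]\wedge E_1)\to E_2$ (replacement of all occurrences outside boxes); $\mathfrak o(D)=(\mathfrak i(D),\mathfrak c(D))$, ordered lexicographically; $\mathfrak c(D)$ is the number of occurrences of connectives in $D$, boxed formulas counting as atoms; $\mathfrak i(D)$ is the maximum of $|I(E)|$ over $E\in I(D)$ ($0$ if there is none); and $I(D)$ is the set of implications that are subformulas of $D$ not in the scope of a box. The TNNIL-algorithm yields $A^+$, recursively on the nesting of boxes, by replacing in $A^*$ each outer box $\square C$ by $\square C^+$. The $\mathrm{TNNIL}^\square$-algorithm yields $A^-$: if $A=B(\square C_1,\dots,\square C_n)$ with $B(p_1,\dots,p_n)$ box-free, then $A^-:=B(\square C_1^+,\dots,\square C_n^+)$. **Corollary.** For every modal formula $A$, the $\mathrm{TNNIL}^\square$-algorithm has an output on the input $A^\square$, and for every output $(A^\square)^-$, $$\mathsf{iH}^*_\sigma\vdash A^\square\leftrightarrow(A^\square)^-.$$ -/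

import Mathlib

/-- Formulas of the propositional modal language, with atomic variables indexed by `ℕ`.
The constant `⊤` is primitive (it is treated like an atom by the NNIL-algorithm). -/
inductive ModalForm : Type
  | atom : ℕ → ModalForm
  | top : ModalForm
  | bot : ModalForm
  | and : ModalForm → ModalForm → ModalForm
  | or : ModalForm → ModalForm → ModalForm
  | imp : ModalForm → ModalForm → ModalForm
  | box : ModalForm → ModalForm
  deriving DecidableEq

namespace ModalForm

/-- `A ↔ B`. -/
def iff (A B : ModalForm) : ModalForm := and (imp A B) (imp B A)

/-- Finite conjunction; the empty conjunction is `⊤`. A finite set of formulas is represented by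
a list. -/
def bigAnd : List ModalForm → ModalForm
  | [] => top
  | [A] => A
  | A :: B :: L => and A (bigAnd (B :: L))

/-- Finite disjunction; the empty disjunction is `⊥`. -/
def bigOr : List ModalForm → ModalForm
  | [] => bot
  | [A] => A
  | A :: B :: L => or A (bigOr (B :: L))

/-- The Beeson-Visser box-translation `A^□`. -/
def boxTr : ModalForm → ModalForm
  | atom n => and (atom n) (box (atom n))
  | top => top
  | bot => bot
  | and A B => and (boxTr A) (boxTr B)
  | or A B => or (boxTr A) (boxTr B)
  | imp A B => and (imp (boxTr A) (boxTr B)) (box (imp (boxTr A) (boxTr B)))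
  | box A => box (boxTr A)

/-! ### Deductive systems -/

/-- Theorems of `IPC_□`: intuitionistic propositional logic in the modal language (a Hilbert
system; there are no axioms about `□`). -/
inductive IPC : ModalForm → Prop
  | k (A B : ModalForm) : IPC (imp A (imp B A))
  | s (A B C : ModalForm) : IPC (imp (imp A (imp B C)) (imp (imp A B) (imp A C)))
  | andLeft (A B : ModalForm) : IPC (imp (and A B) A)
  | andRight (A B : ModalForm) : IPC (imp (and A B) B)
  | andIntro (A B : ModalForm) : IPC (imp A (imp B (and A B)))
  | orLeft (A B : ModalForm) : IPC (imp A (or A B))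
  | orRight (A B : ModalForm) : IPC (imp B (or A B))
  | orElim (A B C : ModalForm) : IPC (imp (imp A C) (imp (imp B C) (imp (or A B) C)))
  | exFalso (A : ModalForm) : IPC (imp bot A)
  | verum : IPC top
  | mp {A B : ModalForm} : IPC (imp A B) → IPC A → IPC B

/-- `IK4With X A`: the formula `A` is a theorem of `iK4 + X`, where `X` is a set of additional
axioms. -/
inductive IK4With (X : Set ModalForm) : ModalForm → Prop
  | ipc {A : ModalForm} : IPC A → IK4With X A
  | axK (A B : ModalForm) : IK4With X (imp (box (imp A B)) (imp (box A) (box B)))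
  | ax4 (A : ModalForm) : IK4With X (imp (box A) (box (box A)))
  | ax {A : ModalForm} : A ∈ X → IK4With X A
  | nec {A : ModalForm} : IK4With X A → IK4With X (box A)
  | mp {A B : ModalForm} : IK4With X (imp A B) → IK4With X A → IK4With X B

/-- Theorems of `iK4`. -/
def IK4 (A : ModalForm) : Prop := IK4With ∅ A

/-- Instances of Löb's axiom `□(□A → A) → □A`. -/
def loebAxioms : Set ModalForm := {D | ∃ A, D = imp (box (imp (box A) A)) (box A)}

/-- Instances of the completeness principle `A → □A`. -/
def cpAxioms : Set ModalForm := {D | ∃ A, D = imp A (box A)}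

/-! ### The relation `▶*` and the theory `iH*_σ` -/

/-- `[A]B`; boxed formulas are treated as atoms. -/
def bracket (A : ModalForm) : ModalForm → ModalForm
  | atom n => atom n
  | top => top
  | bot => bot
  | and B C => and (bracket A B) (bracket A C)
  | or B C => or (bracket A B) (bracket A C)
  | imp B C => imp A (imp B C)
  | box B => box B

/-- `[A]Z := ⋁ {[A]E | E ∈ Z}`. -/
def bracketSet (A : ModalForm) (Z : List ModalForm) : ModalForm := bigOr (Z.map (bracket A))

/-- Atomic variables and boxed formulas. -/
def IsAtomOrBox : ModalForm → Prop
  | atom _ => True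
  | box _ => True
  | _ => False

/-- The relation `A ▶* B`. In `b2` the set of implications `X` is given by the list of the pairs
`(E, F)` with `E → F ∈ X`; there `B = ⋀ X` and `Z = {E | E → F ∈ X} ∪ {C}`. -/
inductive Pres : ModalForm → ModalForm → Prop
  | a1 {A B : ModalForm} : IK4 (imp A B) → Pres A B
  | a2 {A B C : ModalForm} : Pres A B → Pres B C → Pres A C
  | a3 {A B C : ModalForm} : Pres C A → Pres C B → Pres C (and A B)
  | a4 {A B : ModalForm} : Pres A B → Pres (box A) (box B)
  | b1 {A B C : ModalForm} : Pres A C → Pres B C → Pres (or A B) C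
  | b2 (X : List (ModalForm × ModalForm)) (B C : ModalForm)
      (hB : B = bigAnd (X.map fun x => imp x.1 x.2)) :
      Pres (and (imp B C) (box B)) (bracketSet B (X.map Prod.fst ++ [C]))
  | b3 {p A B : ModalForm} : IsAtomOrBox p → Pres A B → Pres (imp p A) (imp p B)

/-- Instances of `□A → □B` with `A ▶* B`. -/
def presAxioms : Set ModalForm := {D | ∃ A B, Pres A B ∧ D = imp (box A) (box B)}

/-- Theorems of `iH*_σ := iGL + CP + {□A → □B | A ▶* B}`. -/
def IHStarSigma (A : ModalForm) : Prop := IK4With (loebAxioms ∪ cpAxioms ∪ presAxioms) A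

/-! ### The NNIL-algorithm

Boxed formulas are treated as atoms throughout, that is, every operation below acts on the
box-free formula obtained by replacing the outer boxed subformulas by fresh atoms. -/

/-- `I(A)`: the set of the implications that are subformulas of `A` not in the scope of `□`. -/
def imps : ModalForm → Finset ModalForm
  | atom _ => ∅
  | top => ∅
  | bot => ∅
  | and A B => imps A ∪ imps B
  | or A B => imps A ∪ imps B
  | imp A B => insert (imp A B) (imps A ∪ imps B)
  | box _ => ∅

/-- `𝔦(A) := max {|I(E)| | E ∈ I(A)}`, and `0` if `I(A)` is empty. -/
def impRank (A : ModalForm) : ℕ := (imps A).sup fun E => (imps E).card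

/-- `𝔠(A)`: the number of occurrences of connectives, boxed formulas counting as atoms. -/
def connCount : ModalForm → ℕ
  | atom _ => 0
  | top => 0
  | bot => 0
  | and A B => connCount A + connCount B + 1
  | or A B => connCount A + connCount B + 1
  | imp A B => connCount A + connCount B + 1
  | box _ => 0

/-- `𝔬(A) < 𝔬(B)` in the lexicographic order. The first component of `𝔬`, the modal depth, is `0`
here, since boxed formulas are treated as atoms. -/
def ComplexityLT (A B : ModalForm) : Prop :=
  impRank A < impRank B ∨ (impRank A = impRank B ∧ connCount A < connCount B)

/-- `A[E → F | F]`: every occurrence of `E → F` in `A` outside boxes is replaced by `F`. -/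
def contract (E F : ModalForm) : ModalForm → ModalForm
  | atom n => atom n
  | top => top
  | bot => bot
  | and A B => and (contract E F A) (contract E F B)
  | or A B => or (contract E F A) (contract E F B)
  | imp A B => if A = E ∧ B = F then F else imp (contract E F A) (contract E F B)
  | box A => box A

/-- `[A]'B`. -/
def bracketPrime (A : ModalForm) : ModalForm → ModalForm
  | atom n => atom n
  | top => top
  | bot => bot
  | and B C => and (bracketPrime A B) (bracketPrime A C)
  | or B C => or (bracketPrime A B) (bracketPrime A C)
  | imp B C => imp (and (contract B C A) B) C
  | box B => box B

/-- `[A]'Z := ⋁ {[A]'E | E ∈ Z}`. -/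
def bracketPrimeSet (A : ModalForm) (Z : List ModalForm) : ModalForm :=
  bigOr (Z.map (bracketPrime A))

/-- Formulas `J(q)` with exactly one occurrence of `q`, which is outer, i.e. in the scope neither
of an implication nor of a box. -/
inductive OuterCtx : Type
  | hole : OuterCtx
  | andL : OuterCtx → ModalForm → OuterCtx
  | andR : ModalForm → OuterCtx → OuterCtx
  | orL : OuterCtx → ModalForm → OuterCtx
  | orR : ModalForm → OuterCtx → OuterCtx

/-- `J[q|D]`. -/
def OuterCtx.fill : OuterCtx → ModalForm → ModalForm
  | .hole, D => D
  | .andL J F, D => and (J.fill D) F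
  | .andR F J, D => and F (J.fill D)
  | .orL J F, D => or (J.fill D) F
  | .orR F J, D => or F (J.fill D)

/-- `A` contains an outer occurrence of a conjunction. -/
def HasOuterAnd (A : ModalForm) : Prop := ∃ (J : OuterCtx) (D E : ModalForm), A = J.fill (and D E)

/-- `A` contains an outer occurrence of a disjunction. -/
def HasOuterOr (A : ModalForm) : Prop := ∃ (J : OuterCtx) (D E : ModalForm), A = J.fill (or D E)

/-- The formulas `B₁, …, Bₙ`, none of them a conjunction, of which `B` is the conjunction (in some
bracketing and possibly with repetitions). -/
def conjunctList : ModalForm → List ModalForm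
  | and A B => conjunctList A ++ conjunctList B
  | A => [A]

/-- The set `X`, as a list without repetitions, with `B = ⋀ X`. -/
def conjuncts (B : ModalForm) : List ModalForm := (conjunctList B).dedup

/-- `A` is an implication. -/
def IsImp (A : ModalForm) : Prop := ∃ E F, A = imp E F

/-- The antecedent `E` of `E → F` (only used for implications). -/
def antecedent : ModalForm → ModalForm
  | imp E _ => E
  | A => A

/-- The consequent `F` of `E → F` (only used for implications). -/
def consequent : ModalForm → ModalForm
  | imp _ F => F
  | A => A

/-- For `B = ⋀ X` and `D = (E → F) ∈ X`: `B ↓ D := ⋀ ((X \ {D}) ∪ {F})`. -/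
def down (X : List ModalForm) (D : ModalForm) : ModalForm :=
  bigAnd ((X.erase D).insert (consequent D))

/-- `{E | E → F ∈ X} ∪ {C}`, as a list without repetitions. -/
def goalSet (X : List ModalForm) (C : ModalForm) : List ModalForm :=
  (X.map antecedent ++ [C]).dedup

/-- `Star A R`: the formula `R` is an output `A^*` of the (nondeterministic) NNIL-algorithm on the
input `A`. In the rules for `B → C` other than `impAnd` and `impOr`, the formula `C` has no outer
conjunction and `B` has no outer disjunction, so that `B = ⋀ X` and `C = ⋁ Y`, where `X` and `Y`
consist of implications, atoms, boxed formulas, `⊤` and `⊥`. The formula `⊤` is the conjunction of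
the empty set, and `⊤ → C` is handled by the last two rules with `X = ∅`. -/
inductive Star : ModalForm → ModalForm → Prop
  | atom (n : ℕ) : Star (atom n) (atom n)
  | top : Star top top
  | bot : Star bot bot
  | box (A : ModalForm) : Star (box A) (box A)
  | and {B C B' C' : ModalForm} : Star B B' → Star C C' → Star (and B C) (and B' C')
  | or {B C B' C' : ModalForm} : Star B B' → Star C C' → Star (or B C) (or B' C')
  | impAnd (B : ModalForm) (J : OuterCtx) (D E : ModalForm) {R₁ R₂ : ModalForm} :
      Star (imp B (J.fill D)) R₁ → Star (imp B (J.fill E)) R₂ →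
      Star (imp B (J.fill (and D E))) (and R₁ R₂)
  | impOr (C : ModalForm) (J : OuterCtx) (D E : ModalForm) {R₁ R₂ : ModalForm} :
      Star (imp (J.fill D) C) R₁ → Star (imp (J.fill E) C) R₂ →
      Star (imp (J.fill (or D E)) C) (and R₁ R₂)
  | impAtom (B C p : ModalForm) {R : ModalForm} :
      ¬ HasOuterAnd C → ¬ HasOuterOr B → p ∈ conjuncts B → IsAtomOrBox p →
      Star (imp (bigAnd ((conjuncts B).erase p)) C) R →
      Star (imp B C) (imp p R)
  | impTop (B C : ModalForm) {R : ModalForm} :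
      ¬ HasOuterAnd C → ¬ HasOuterOr B → .top ∈ conjuncts B → B ≠ .top →
      Star (imp (bigAnd ((conjuncts B).erase .top)) C) R →
      Star (imp B C) R
  | impBot (B C : ModalForm) :
      ¬ HasOuterAnd C → ¬ HasOuterOr B → .bot ∈ conjuncts B →
      Star (imp B C) .top
  | impImps (B C : ModalForm) (X : List ModalForm) (f : ModalForm → ModalForm) {R : ModalForm} :
      ¬ HasOuterAnd C → ¬ HasOuterOr B →
      (X = conjuncts B ∨ (B = .top ∧ X = [])) → (∀ D ∈ X, IsImp D) →
      (∀ D ∈ X, Star (imp (down X D) C) (f D)) →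
      ComplexityLT (bracketSet B (goalSet X C)) (imp B C) →
      Star (bracketSet B (goalSet X C)) R →
      Star (imp B C) (.and (bigAnd (X.map f)) R)
  | impImpsPrime (B C : ModalForm) (X : List ModalForm) (f : ModalForm → ModalForm)
      {R : ModalForm} :
      ¬ HasOuterAnd C → ¬ HasOuterOr B →
      (X = conjuncts B ∨ (B = .top ∧ X = [])) → (∀ D ∈ X, IsImp D) →
      (∀ D ∈ X, Star (imp (down X D) C) (f D)) →
      ¬ ComplexityLT (bracketSet B (goalSet X C)) (imp B C) →
      Star (bracketPrimeSet B (goalSet X C)) R →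
      Star (imp B C) (.and (bigAnd (X.map f)) R)

/-! ### The TNNIL-algorithm and the TNNIL^□-algorithm -/

/-- The set of the formulas `B` such that `□B` is an outer boxed subformula of `A`, i.e. one that
has an occurrence in `A` that is not in the scope of another box. -/
def outerBoxes : ModalForm → Set ModalForm
  | atom _ => ∅
  | top => ∅
  | bot => ∅
  | and A B => outerBoxes A ∪ outerBoxes B
  | or A B => outerBoxes A ∪ outerBoxes B
  | imp A B => outerBoxes A ∪ outerBoxes B
  | box A => {A}

/-- Replacement of every outer boxed subformula `□B` by `□(g B)`. -/
def mapBox (g : ModalForm → ModalForm) : ModalForm → ModalForm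
  | atom n => atom n
  | top => top
  | bot => bot
  | and A B => and (mapBox g A) (mapBox g B)
  | or A B => or (mapBox g A) (mapBox g B)
  | imp A B => imp (mapBox g A) (mapBox g B)
  | box A => box (g A)

/-- `Plus A R`: the formula `R` is an output `A^+` of the TNNIL-algorithm on the input `A`: it is
obtained from an output `A^*` by replacing every outer `□B` by `□B^+`. -/
inductive Plus : ModalForm → ModalForm → Prop
  | mk (A S : ModalForm) (g : ModalForm → ModalForm) :
      Star A S → (∀ B ∈ outerBoxes A, Plus B (g B)) → Plus A (mapBox g S)

/-- `Minus A R`: the formula `R` is an output `A^-` of the TNNIL^□-algorithm on the input `A`: it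
is obtained from `A` by replacing every outer `□B` by `□B^+`. -/
def Minus (A R : ModalForm) : Prop :=
  ∃ g : ModalForm → ModalForm, (∀ B ∈ outerBoxes A, Plus B (g B)) ∧ R = mapBox g A

end ModalForm

/-! Since `A^-` only rewrites outer boxes, replacement of equivalents (`Der.mapBox_iff`) reduces the
equivalence to `□C ↔ □C^+` for the formulas `C` that occur under a box in a box-translation. These
are atoms, formulas `A^□`, and implications `A^□ → B^□`, a class closed under passing to outer boxes
(`BoxTrClosed`), so one can induct on the run of the TNNIL-algorithm. Outer boxes of `C^*` are
already outer boxes of `C` (`outerBoxes_star`), hence the induction hypothesis turns `C^*` into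
`C^+`, and what remains is to compare `□C` with `□C^*`.

From right to left, `C^* → C` is intuitionistically valid for every `C` (`Der.of_star`), and `□` is
monotone. From left to right, it suffices that `C ▶* C^*`. The rules of `▶*` follow the steps of the
algorithm, except that (B2) demands `□B` besides `B → C`. For arbitrary `C` this box is not
available, and this is where the box-translation enters: there each atom `p` comes with `□p` and
each implication with its own box. When the algorithm reaches an antecedent `B` made of implications
only, the atoms and boxes that guarded them have been split off and collected in a formula `γ`, and
`γ` proves `□B` in `iK4`. The invariant `Pers` expresses this with polarities: antecedents must
imply their own necessity by means of their non-implicational members, hereditarily.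
Box-translations satisfy it (`pers_boxTr`), every step of the algorithm preserves it, and
`Pres.of_star` concludes `γ ∧ A ▶* A^*`.

Existence of outputs is a well-founded recursion on `𝔬`. The delicate step is `[B]'Z`: contracting
`U → V` to `V` removes one implication, which pays for the new outer one, so the rank `𝔦` drops
strictly (`complexityLT_bracketPrimeSet`). -/

namespace ModalForm

/-! ### Local derivability -/

/-- `Der T Γ A`: `A` follows by modus ponens from `Γ` and the theorems of `iK4 + T`. -/
inductive Der (T Γ : Set ModalForm) : ModalForm → Prop
  | thm {A : ModalForm} : IK4With T A → Der T Γ A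
  | hyp {A : ModalForm} : A ∈ Γ → Der T Γ A
  | mp {A B : ModalForm} : Der T Γ (imp A B) → Der T Γ A → Der T Γ B

theorem IPC.imp_self (A : ModalForm) : IPC (imp A A) :=
  .mp (.mp (.s A (imp A A) A) (.k _ _)) (.k A A)

namespace Der

variable {T Γ Δ : Set ModalForm} {A B C : ModalForm}

theorem ipc (h : IPC A) : Der T Γ A := .thm (.ipc h)

theorem cut (h : ∀ x ∈ Γ, Der T Δ x) (hA : Der T Γ A) : Der T Δ A := by
  induction hA with
  | thm h => exact .thm h
  | hyp hx => exact h _ hx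
  | mp _ _ ih₁ ih₂ => exact .mp ih₁ ih₂

theorem weaken (h : Γ ⊆ Δ) (hA : Der T Γ A) : Der T Δ A := hA.cut fun _ hx => .hyp (h hx)

theorem insert (hA : Der T Γ A) : Der T (Insert.insert B Γ) A :=
  hA.weaken (Set.subset_insert _ _)

theorem head : Der T (Insert.insert A Γ) A := .hyp (Set.mem_insert _ _)

theorem self : Der T {A} A := .hyp rfl

theorem impI (h : Der T (Insert.insert A Γ) B) : Der T Γ (imp A B) := by
  induction h with
  | thm h => exact .mp (ipc (.k _ _)) (.thm h)
  | hyp hx =>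
    rcases hx with rfl | hx
    · exact ipc (IPC.imp_self _)
    · exact .mp (ipc (.k _ _)) (.hyp hx)
  | mp _ _ ih₁ ih₂ => exact .mp (.mp (ipc (.s _ _ _)) ih₁) ih₂

theorem toThm (h : Der T ∅ A) : IK4With T A := by
  induction h with
  | thm h => exact h
  | hyp hx => exact hx.elim
  | mp _ _ ih₁ ih₂ => exact .mp ih₁ ih₂

theorem toImp (h : Der T {A} B) : IK4With T (imp A B) := by
  refine toThm (impI ?_)
  simpa using h

theorem andI (h₁ : Der T Γ A) (h₂ : Der T Γ B) : Der T Γ (and A B) :=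
  .mp (.mp (ipc (.andIntro _ _)) h₁) h₂

theorem andL (h : Der T Γ (and A B)) : Der T Γ A := .mp (ipc (.andLeft _ _)) h

theorem andR (h : Der T Γ (and A B)) : Der T Γ B := .mp (ipc (.andRight _ _)) h

theorem and_iff : Der T Γ (and A B) ↔ Der T Γ A ∧ Der T Γ B :=
  ⟨fun h => ⟨h.andL, h.andR⟩, fun h => h.1.andI h.2⟩

theorem orL (h : Der T Γ A) : Der T Γ (or A B) := .mp (ipc (.orLeft _ _)) h

theorem orR (h : Der T Γ B) : Der T Γ (or A B) := .mp (ipc (.orRight _ _)) h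

theorem orE (h : Der T Γ (or A B)) (h₁ : Der T (Insert.insert A Γ) C)
    (h₂ : Der T (Insert.insert B Γ) C) : Der T Γ C :=
  .mp (.mp (.mp (ipc (.orElim _ _ _)) h₁.impI) h₂.impI) h

theorem topI : Der T Γ top := ipc .verum

theorem botE (h : Der T Γ bot) : Der T Γ A := .mp (ipc (.exFalso _)) h

theorem box_mp (h : Der T Γ (box (imp A B))) (hA : Der T Γ (box A)) : Der T Γ (box B) :=
  .mp (.mp (.thm (.axK _ _)) h) hA

theorem box_mono (h : IK4With T (imp A B)) (hA : Der T Γ (box A)) : Der T Γ (box B) :=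
  box_mp (.thm (.nec h)) hA

theorem box_and (hA : Der T Γ (box A)) (hB : Der T Γ (box B)) : Der T Γ (box (and A B)) :=
  box_mp (box_mono (.ipc (.andIntro _ _)) hA) hB

theorem box_box (hA : Der T Γ (box A)) : Der T Γ (box (box A)) := .mp (.thm (.ax4 _)) hA

theorem box_bigAnd : ∀ {L : List ModalForm}, (∀ x ∈ L, Der T Γ (box x)) → Der T Γ (box (bigAnd L))
  | [], _ => .thm (.nec (.ipc .verum))
  | [A], h => h A (by simp)
  | _ :: _ :: _, h => box_and (h _ (by simp)) (box_bigAnd fun x hx => h x (by simp_all))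

theorem bigAnd_iff : ∀ {L : List ModalForm}, Der T Γ (bigAnd L) ↔ ∀ x ∈ L, Der T Γ x
  | [] => by simp [bigAnd, topI]
  | [_] => by simp [bigAnd]
  | A :: B :: L => by rw [bigAnd, and_iff, bigAnd_iff]; simp

theorem bigOr_intro : ∀ {L : List ModalForm}, A ∈ L → Der T Γ A → Der T Γ (bigOr L)
  | [_], h, hA => by simp at h; subst h; exact hA
  | _ :: B :: L, h, hA => by
    rcases List.mem_cons.1 h with rfl | h
    · exact orL hA
    · exact orR (bigOr_intro h hA)

theorem bigOr_elim : ∀ {L : List ModalForm} {Γ : Set ModalForm}, Der T Γ (bigOr L) →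
    (∀ x ∈ L, Der T (Insert.insert x Γ) C) → Der T Γ C
  | [], _, h, _ => botE h
  | [A], _, h, hC => .mp (hC A (by simp)).impI h
  | A :: B :: L, Γ, h, hC => orE h (hC _ (by simp))
    (bigOr_elim head fun x hx => (hC x (by simp_all)).weaken (by
      intro y hy; simp only [Set.mem_insert_iff] at hy ⊢; tauto))

theorem conjunctList_iff : ∀ {B : ModalForm}, Der T Γ B ↔ ∀ x ∈ conjunctList B, Der T Γ x
  | and A B => by
    rw [and_iff, conjunctList_iff (B := A), conjunctList_iff (B := B)]
    simp only [conjunctList, List.mem_append]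
    exact ⟨fun h x hx => hx.elim (h.1 x) (h.2 x), fun h => ⟨fun x hx => h x (.inl hx),
      fun x hx => h x (.inr hx)⟩⟩
  | .atom _ | .top | .bot | .or _ _ | .imp _ _ | .box _ => by simp [conjunctList]

theorem conjuncts_iff : Der T Γ B ↔ ∀ x ∈ conjuncts B, Der T Γ x := by
  simp only [conjuncts, List.mem_dedup]; exact conjunctList_iff

theorem fill_mono : ∀ (J : OuterCtx) {Γ : Set ModalForm}, Der T Γ (J.fill A) →
    Der T Γ (imp A B) → Der T Γ (J.fill B)
  | .hole, _, h, i => .mp i h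
  | .andL J _, _, h, i => andI (fill_mono J h.andL i) h.andR
  | .andR _ J, _, h, i => andI h.andL (fill_mono J h.andR i)
  | .orL J _, _, h, i => orE h (orL (fill_mono J head i.insert)) (orR head)
  | .orR _ J, _, h, i => orE h (orL head) (orR (fill_mono J head i.insert))

/-- The hole lies under `∧` and `∨` only and occurs once, so `J(q)` is equivalent to some `a ∨ (b ∧
q)`; distributivity makes such a context commute with `∧`, and likewise with `∨` in `fill_or`. -/
theorem fill_and : ∀ (J : OuterCtx) {Γ : Set ModalForm}, Der T Γ (J.fill A) →
    Der T Γ (J.fill B) → Der T Γ (J.fill (and A B))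
  | .hole, _, h, i => andI h i
  | .andL J _, _, h, i => andI (fill_and J h.andL i.andL) h.andR
  | .andR _ J, _, h, i => andI h.andL (fill_and J h.andR i.andR)
  | .orL J _, _, h, i =>
    orE h (orE i.insert (orL (fill_and J head.insert head)) (orR head)) (orR head)
  | .orR _ J, _, h, i =>
    orE h (orL head) (orE i.insert (orL head) (orR (fill_and J head.insert head)))

theorem fill_or : ∀ (J : OuterCtx) {Γ : Set ModalForm}, Der T Γ (J.fill (or A B)) →
    Der T Γ (or (J.fill A) (J.fill B))
  | .hole, _, h => h
  | .andL J _, _, h => orE (fill_or J h.andL) (orL (andI head h.andR.insert))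
      (orR (andI head h.andR.insert))
  | .andR _ J, _, h => orE (fill_or J h.andR) (orL (andI h.andL.insert head))
      (orR (andI h.andL.insert head))
  | .orL J _, _, h => orE h (orE (fill_or J head) (orL (orL head)) (orR (orL head)))
      (orL (orR head))
  | .orR _ J, _, h => orE h (orL (orL head))
      (orE (fill_or J head) (orL (orR head)) (orR (orR head)))

/-- Given `E`, the formulas `A` and `A[E → F | F]` are equivalent. -/
theorem contract_iff {E F : ModalForm} : ∀ (A : ModalForm) {Γ : Set ModalForm}, Der T Γ E →
    (Der T Γ (contract E F A) ↔ Der T Γ A)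
  | .atom _, _, _ | .top, _, _ | .bot, _, _ | .box _, _, _ => Iff.rfl
  | .and A B, _, h => by
    rw [contract, and_iff, and_iff, contract_iff A h, contract_iff B h]
  | .or A B, _, h => by
    rw [contract]
    exact ⟨fun i => orE i (orL ((contract_iff A h.insert).1 head))
        (orR ((contract_iff B h.insert).1 head)),
      fun i => orE i (orL ((contract_iff A h.insert).2 head))
        (orR ((contract_iff B h.insert).2 head))⟩
  | .imp A B, _, h => by
    rw [contract]
    split_ifs with hc
    · obtain ⟨rfl, rfl⟩ := hc
      exact ⟨fun i => i.insert.impI, fun i => i.mp h⟩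
    · exact ⟨fun i => impI ((contract_iff B h.insert).1
          (i.insert.mp ((contract_iff A h.insert).2 head))),
        fun i => impI ((contract_iff B h.insert).2
          (i.insert.mp ((contract_iff A h.insert).1 head)))⟩

theorem box_contract {E F : ModalForm} (hE : Der T Γ (box E)) (hA : Der T Γ (box A)) :
    Der T Γ (box (contract E F A)) :=
  box_mono (A := and E A) (toImp ((contract_iff A self.andL).2 self.andR)) (box_and hE hA)

/-! ### The bracket operations `[B]` and `[B]'` -/

/-- `B ∧ [B]A → A`. -/
theorem of_bracket {B : ModalForm} : ∀ (A : ModalForm) {Γ : Set ModalForm}, Der T Γ B →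
    Der T Γ (bracket B A) → Der T Γ A
  | .atom _, _, _, h | .top, _, _, h | .bot, _, _, h | .box _, _, _, h => h
  | .and A A', _, hB, h => andI (of_bracket A hB h.andL) (of_bracket A' hB h.andR)
  | .or A A', _, hB, h => orE h (orL (of_bracket A hB.insert head))
      (orR (of_bracket A' hB.insert head))
  | .imp _ _, _, hB, h => h.mp hB

/-- `B ∧ [B]'A → A`. -/
theorem of_bracketPrime {B : ModalForm} : ∀ (A : ModalForm) {Γ : Set ModalForm}, Der T Γ B →
    Der T Γ (bracketPrime B A) → Der T Γ A
  | .atom _, _, _, h | .top, _, _, h | .bot, _, _, h | .box _, _, _, h => h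
  | .and A A', _, hB, h => andI (of_bracketPrime A hB h.andL) (of_bracketPrime A' hB h.andR)
  | .or A A', _, hB, h => orE h (orL (of_bracketPrime A hB.insert head))
      (orR (of_bracketPrime A' hB.insert head))
  -- Once the antecedent `E₁` is assumed, `B` and its contraction coincide.
  | .imp _ _, _, hB, h => impI (h.insert.mp (andI ((contract_iff B head).2 hB.insert) head))

theorem bracket_mono {B B' : ModalForm} : ∀ (A : ModalForm) {Γ : Set ModalForm},
    Der T Γ (imp B' B) → Der T Γ (bracket B A) → Der T Γ (bracket B' A)
  | .atom _, _, _, h | .top, _, _, h | .bot, _, _, h | .box _, _, _, h => h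
  | .and A A', _, hB, h => andI (bracket_mono A hB h.andL) (bracket_mono A' hB h.andR)
  | .or A A', _, hB, h => orE h (orL (bracket_mono A hB.insert head))
      (orR (bracket_mono A' hB.insert head))
  | .imp _ _, _, hB, h => impI (h.insert.mp (hB.insert.mp head))

theorem bracketPrime_of_bracket {B : ModalForm} : ∀ (A : ModalForm) {Γ : Set ModalForm},
    Der T Γ (bracket B A) → Der T Γ (bracketPrime B A)
  | .atom _, _, h | .top, _, h | .bot, _, h | .box _, _, h => h
  | .and A A', _, h => andI (bracketPrime_of_bracket A h.andL) (bracketPrime_of_bracket A' h.andR)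
  | .or A A', _, h => orE h (orL (bracketPrime_of_bracket A head))
      (orR (bracketPrime_of_bracket A' head))
  | .imp _ _, _, h => impI (mp (h.insert.mp ((contract_iff B head.andR).1 head.andL)) head.andR)

theorem bigOr_map {f g : ModalForm → ModalForm} {L : List ModalForm} {Γ : Set ModalForm}
    (h : Der T Γ (bigOr (L.map f)))
    (hfg : ∀ x ∈ L, Der T (Insert.insert (f x) Γ) (g x)) : Der T Γ (bigOr (L.map g)) := by
  refine bigOr_elim h fun y hy => ?_
  obtain ⟨x, hx, rfl⟩ := List.mem_map.1 hy
  exact bigOr_intro (List.mem_map_of_mem hx) (hfg x hx)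

end Der

/-! ### Outer disjunctions and conjuncts -/

theorem hasOuterOr_or (A B : ModalForm) : HasOuterOr (or A B) := ⟨.hole, A, B, rfl⟩

theorem HasOuterOr.andL {A B : ModalForm} : HasOuterOr A → HasOuterOr (and A B) := by
  rintro ⟨J, D, E, rfl⟩
  exact ⟨.andL J B, D, E, rfl⟩

theorem HasOuterOr.andR {A B : ModalForm} : HasOuterOr B → HasOuterOr (and A B) := by
  rintro ⟨J, D, E, rfl⟩
  exact ⟨.andR A J, D, E, rfl⟩

/-- Formulas that are neither conjunctions nor disjunctions. -/
def IsLit : ModalForm → Prop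
  | and _ _ => False
  | or _ _ => False
  | _ => True

theorem isLit_of_mem_conjunctList : ∀ {B x : ModalForm}, ¬ HasOuterOr B → x ∈ conjunctList B →
    IsLit x
  | and A B, x, h, hx => by
    rcases List.mem_append.1 hx with hx | hx
    · exact isLit_of_mem_conjunctList (fun h' => h h'.andL) hx
    · exact isLit_of_mem_conjunctList (fun h' => h h'.andR) hx
  | .or A B, _, h, _ => (h (hasOuterOr_or A B)).elim
  | .atom _, _, _, hx | .top, _, _, hx | .bot, _, _, hx | .imp _ _, _, _, hx | .box _, _, _, hx => by
    simp [conjunctList] at hx; subst hx; trivial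

/-- The disjuncts of a formula in which implications and boxed formulas are treated as atoms, each
given as the set of its conjuncts. -/
def sel : ModalForm → Set (Set ModalForm)
  | and A B => {S | ∃ Y ∈ sel A, ∃ Z ∈ sel B, S = Y ∪ Z}
  | or A B => sel A ∪ sel B
  | A => {{A}}

theorem sel_of_isLit {A : ModalForm} (h : IsLit A) : sel A = {{A}} := by
  cases A <;> first | rfl | exact h.elim

theorem sel_of_not_hasOuterOr : ∀ {B : ModalForm}, ¬ HasOuterOr B →
    sel B = {{x | x ∈ conjunctList B}}
  | and A B, h => by
    rw [sel, sel_of_not_hasOuterOr (B := A) fun h' => h h'.andL,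
      sel_of_not_hasOuterOr (B := B) fun h' => h h'.andR]
    ext S
    simp only [Set.mem_singleton_iff, exists_eq_left, Set.mem_ofPred_eq, conjunctList,
      List.mem_append]
    rfl
  | .or A B, h => (h (hasOuterOr_or A B)).elim
  | .atom _, _ | .top, _ | .bot, _ | .imp _ _, _ | .box _, _ => by simp [sel, conjunctList]

theorem sel_fill_mono {A B : ModalForm} (h : sel A ⊆ sel B) :
    ∀ J : OuterCtx, sel (J.fill A) ⊆ sel (J.fill B)
  | .hole => h
  | .andL J _ => by
    rintro S ⟨Y, hY, Z, hZ, rfl⟩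
    exact ⟨Y, sel_fill_mono h J hY, Z, hZ, rfl⟩
  | .andR _ J => by
    rintro S ⟨Y, hY, Z, hZ, rfl⟩
    exact ⟨Y, hY, Z, sel_fill_mono h J hZ, rfl⟩
  | .orL J _ => Set.union_subset_union_left _ (sel_fill_mono h J)
  | .orR _ J => Set.union_subset_union_right _ (sel_fill_mono h J)

/-- The exception `x = top` is caused by the empty conjunction, which is the literal `⊤`. -/
theorem sel_bigAnd : ∀ {L : List ModalForm} {S : Set ModalForm}, (∀ x ∈ L, IsLit x) →
    S ∈ sel (bigAnd L) → (∀ x ∈ L, x ∈ S) ∧ ∀ x ∈ S, x ∈ L ∨ x = top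
  | [], S, _, hS => by
    simp only [bigAnd, sel, Set.mem_singleton_iff] at hS
    subst hS; simp
  | [A], S, hL, hS => by
    rw [bigAnd, sel_of_isLit (hL A (by simp)), Set.mem_singleton_iff] at hS
    subst hS; simp
  | A :: B :: L, S, hL, hS => by
    obtain ⟨Y, hY, Z, hZ, rfl⟩ := hS
    rw [sel_of_isLit (hL A (by simp)), Set.mem_singleton_iff] at hY
    subst hY
    have := sel_bigAnd (fun x hx => hL x (List.mem_cons_of_mem _ hx)) hZ
    constructor
    · intro x hx
      rcases List.mem_cons.1 hx with rfl | hx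
      · exact .inl rfl
      · exact .inr (this.1 x hx)
    · rintro x (hx | hx)
      · exact .inl (List.mem_cons.2 (.inl hx))
      · exact (this.2 x hx).imp_left (List.mem_cons_of_mem _)

/-- The members of `Y` that are not implications. -/
def lits (Y : Set ModalForm) : Set ModalForm := {D ∈ Y | ¬ IsImp D}

theorem lits_mono {Y Z : Set ModalForm} (h : Y ⊆ Z) : lits Y ⊆ lits Z := fun _ hx => ⟨h hx.1, hx.2⟩

theorem isImp_imp (A B : ModalForm) : IsImp (imp A B) := ⟨A, B, rfl⟩

/-- A disjunct of `A[E → F | F]` arises from one of `A` by contracting its members other than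
`E → F` and replacing `E → F` by a disjunct of `F`. -/
theorem sel_contract {E F : ModalForm} : ∀ {A : ModalForm} {S : Set ModalForm},
    S ∈ sel (contract E F A) → ∃ Y ∈ sel A, lits Y ⊆ lits S ∧ ∀ x ∈ S,
      (∃ D ∈ Y, D ≠ imp E F ∧ x = contract E F D ∧ (¬ IsImp D → x = D)) ∨
      (imp E F ∈ Y ∧ ∃ W ∈ sel F, W ⊆ S ∧ x ∈ W)
  | .atom _, S, hS | .top, S, hS | .bot, S, hS | .box _, S, hS => by
    refine ⟨S, hS, subset_rfl, fun x hx => .inl ?_⟩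
    simp only [contract, sel, Set.mem_singleton_iff] at hS
    subst hS
    simp only [Set.mem_singleton_iff] at hx
    subst hx
    simp [contract]
  | .imp A B, S, hS => by
    rw [contract] at hS
    refine ⟨{imp A B}, rfl, ?_, fun x hx => ?_⟩
    -- The only member of the disjunct is an implication, so its `lits` is empty.
    · rintro x ⟨hx, hx'⟩
      exact (hx' ⟨A, B, hx⟩).elim
    split_ifs at hS with hc
    · obtain ⟨rfl, rfl⟩ := hc
      exact .inr ⟨rfl, S, hS, subset_rfl, hx⟩
    · simp only [sel, Set.mem_singleton_iff] at hS
      subst hS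
      refine .inl ⟨imp A B, rfl, ?_, ?_, ?_⟩
      · simpa using hc
      · rw [contract, if_neg hc]; exact hx
      · exact fun h => (h (isImp_imp _ _)).elim
  | .or A B, S, hS => by
    rcases hS with hS | hS
    · obtain ⟨Y, hY, h⟩ := sel_contract hS
      exact ⟨Y, .inl hY, h⟩
    · obtain ⟨Y, hY, h⟩ := sel_contract hS
      exact ⟨Y, .inr hY, h⟩
  | .and A B, _, ⟨S₁, h₁, S₂, h₂, hS⟩ => by
    subst hS
    obtain ⟨Y, hY, hY', hY''⟩ := sel_contract h₁
    obtain ⟨Z, hZ, hZ', hZ''⟩ := sel_contract h₂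
    refine ⟨Y ∪ Z, ⟨Y, hY, Z, hZ, rfl⟩, ?_, ?_⟩
    · rintro x ⟨hx | hx, hx'⟩
      · exact lits_mono Set.subset_union_left (hY' ⟨hx, hx'⟩)
      · exact lits_mono Set.subset_union_right (hZ' ⟨hx, hx'⟩)
    · rintro x (hx | hx)
      · rcases hY'' x hx with ⟨D, hD, h⟩ | ⟨h, W, hW, hW', hx⟩
        · exact .inl ⟨D, .inl hD, h⟩
        · exact .inr ⟨.inl h, W, hW, hW'.trans Set.subset_union_left, hx⟩
      · rcases hZ'' x hx with ⟨D, hD, h⟩ | ⟨h, W, hW, hW', hx⟩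
        · exact .inl ⟨D, .inr hD, h⟩
        · exact .inr ⟨.inr h, W, hW, hW'.trans Set.subset_union_right, hx⟩

/-- Each disjunct, read as a conjunction, implies the formula, and `□` commutes with `∧` and is
monotone. -/
theorem Der.box_of_sel {T Γ : Set ModalForm} : ∀ {A : ModalForm} {Y : Set ModalForm}, Y ∈ sel A →
    (∀ D ∈ Y, Der T Γ (box D)) → Der T Γ (box A)
  | .atom _, _, hY, h | .top, _, hY, h | .bot, _, hY, h | .box _, _, hY, h
  | .imp _ _, _, hY, h => h _ (by simp only [sel, Set.mem_singleton_iff] at hY; subst hY; rfl)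
  | .or _ _, _, .inl hY, h => box_mono (.ipc (.orLeft _ _)) (box_of_sel hY h)
  | .or _ _, _, .inr hY, h => box_mono (.ipc (.orRight _ _)) (box_of_sel hY h)
  | .and _ _, _, ⟨_, hY, _, hZ, hS⟩, h => by
    subst hS
    exact box_and (box_of_sel hY fun D hD => h D (.inl hD))
      (box_of_sel hZ fun D hD => h D (.inr hD))

/-! ### Persistent formulas -/

/-- `Pers false Γ A`: over `Γ`, every disjunct of `A` implies its own necessity already by means of
its members that are not implications, and this holds hereditarily. `Pers true Γ A`: this
holds of the antecedents of the outer implications in `A`, and hereditarily in their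
consequents. -/
inductive Pers : Bool → Set ModalForm → ModalForm → Prop
  | atom (Γ : Set ModalForm) (n : ℕ) : Pers true Γ (atom n)
  | top (Γ : Set ModalForm) : Pers true Γ top
  | bot (Γ : Set ModalForm) : Pers true Γ bot
  | box (Γ : Set ModalForm) (A : ModalForm) : Pers true Γ (box A)
  | and {Γ : Set ModalForm} {A B : ModalForm} :
      Pers true Γ A → Pers true Γ B → Pers true Γ (and A B)
  | or {Γ : Set ModalForm} {A B : ModalForm} :
      Pers true Γ A → Pers true Γ B → Pers true Γ (or A B)
  | imp {Γ : Set ModalForm} {A B : ModalForm} :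
      Pers false Γ A → Pers true Γ B → Pers true Γ (imp A B)
  | neg {Γ : Set ModalForm} {A : ModalForm} :
      (∀ Y ∈ sel A, ∀ D ∈ Y, Der ∅ (Γ ∪ lits Y) (ModalForm.box D)) →
      (∀ Y ∈ sel A, ∀ E F, ModalForm.imp E F ∈ Y → Pers true (Γ ∪ lits Y) E) →
      (∀ Y ∈ sel A, ∀ E F, ModalForm.imp E F ∈ Y → Pers false (Γ ∪ lits Y) F) →
      Pers false Γ A

theorem Der.cut_union {T Γ Δ Y Z : Set ModalForm} (h : ∀ x ∈ Γ, Der T Δ x) (hY : Y ⊆ Z) :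
    ∀ x ∈ Γ ∪ Y, Der T (Δ ∪ Z) x := by
  rintro x (hx | hx)
  · exact (h x hx).weaken Set.subset_union_left
  · exact .hyp (.inr (hY hx))

namespace Pers

/-- Contexts enter `Pers` only through derivability. This allows `γ` to be replaced by `γ ∧ p` when
`p` is split off. -/
theorem cut {b : Bool} {Γ Δ : Set ModalForm} {A : ModalForm} (h : Pers b Γ A)
    (hΓ : ∀ x ∈ Γ, Der ∅ Δ x) : Pers b Δ A := by
  induction h generalizing Δ with
  | atom => exact .atom _ _
  | top => exact .top _
  | bot => exact .bot _
  | box => exact .box _ _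
  | and _ _ h₁ h₂ => exact .and (h₁ hΓ) (h₂ hΓ)
  | or _ _ h₁ h₂ => exact .or (h₁ hΓ) (h₂ hΓ)
  | imp _ _ h₁ h₂ => exact .imp (h₁ hΓ) (h₂ hΓ)
  | neg h _ _ h₁ h₂ =>
    have hc Y := Der.cut_union hΓ (subset_refl (lits Y))
    exact .neg (fun Y hY D hD => (h Y hY D hD).cut (hc Y))
      (fun Y hY E F hD => h₁ Y hY E F hD (hc Y)) (fun Y hY E F hD => h₂ Y hY E F hD (hc Y))

theorem weaken {b : Bool} {Γ Δ : Set ModalForm} {A : ModalForm} (h : Pers b Γ A) (hΓ : Γ ⊆ Δ) :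
    Pers b Δ A := h.cut fun _ hx => .hyp (hΓ hx)

/-- A disjunct of `A ∧ B` is a union `Y ∪ Z`, so the conditions on `B` may already use `lits Y`.
This asymmetric form is what `bracketPrime` requires. -/
theorem neg_and {Γ : Set ModalForm} {A B : ModalForm} (hA : Pers false Γ A)
    (hB : ∀ Y ∈ sel A, Pers false (Γ ∪ lits Y) B) : Pers false Γ (ModalForm.and A B) := by
  have sub₁ (Y Z : Set ModalForm) : Γ ∪ lits Y ⊆ Γ ∪ lits (Y ∪ Z) :=
    Set.union_subset_union_right _ (lits_mono Set.subset_union_left)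
  have sub₂ (Y Z : Set ModalForm) : Γ ∪ lits Y ∪ lits Z ⊆ Γ ∪ lits (Y ∪ Z) :=
    Set.union_subset (sub₁ Y Z)
      ((lits_mono Set.subset_union_right).trans Set.subset_union_right)
  cases hA with
  | neg a₁ a₂ a₃ =>
    refine .neg ?_ ?_ ?_ <;> rintro _ ⟨Y, hY, Z, hZ, rfl⟩
    · rintro D (hD | hD)
      · exact (a₁ Y hY D hD).weaken (sub₁ _ _)
      · cases hB Y hY with
        | neg b₁ b₂ b₃ => exact (b₁ Z hZ D hD).weaken (sub₂ _ _)
    · rintro E F (hD | hD)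
      · exact (a₂ Y hY E F hD).weaken (sub₁ _ _)
      · cases hB Y hY with
        | neg b₁ b₂ b₃ => exact (b₂ Z hZ E F hD).weaken (sub₂ _ _)
    · rintro E F (hD | hD)
      · exact (a₃ Y hY E F hD).weaken (sub₁ _ _)
      · cases hB Y hY with
        | neg b₁ b₂ b₃ => exact (b₃ Z hZ E F hD).weaken (sub₂ _ _)

theorem neg_mono {Γ : Set ModalForm} {A B : ModalForm} (hA : Pers false Γ A)
    (h : sel B ⊆ sel A) : Pers false Γ B := by
  cases hA with
  | neg a₁ a₂ a₃ =>
    exact .neg (fun Y hY => a₁ Y (h hY)) (fun Y hY => a₂ Y (h hY)) (fun Y hY => a₃ Y (h hY))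

theorem neg_or {Γ : Set ModalForm} {A B : ModalForm} (hA : Pers false Γ A)
    (hB : Pers false Γ B) : Pers false Γ (ModalForm.or A B) := by
  cases hA with
  | neg a₁ a₂ a₃ =>
    cases hB with
    | neg b₁ b₂ b₃ =>
      exact .neg (fun Y hY => hY.elim (a₁ Y) (b₁ Y)) (fun Y hY => hY.elim (a₂ Y) (b₂ Y))
        (fun Y hY => hY.elim (a₃ Y) (b₃ Y))

theorem neg_of_isLit {Γ : Set ModalForm} {A : ModalForm} (hA : IsLit A) (hA' : ¬ IsImp A)
    (h : Der ∅ (insert A Γ) (ModalForm.box A)) : Pers false Γ A := by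
  refine .neg ?_ ?_ ?_ <;> rw [sel_of_isLit hA] <;> rintro _ rfl
  · rintro _ rfl
    refine h.weaken ?_
    rintro x (rfl | hx)
    · exact .inr ⟨rfl, hA'⟩
    · exact .inl hx
  · rintro E F rfl
    exact (hA' (isImp_imp _ _)).elim
  · rintro E F rfl
    exact (hA' (isImp_imp _ _)).elim

theorem neg_top (Γ : Set ModalForm) : Pers false Γ ModalForm.top :=
  neg_of_isLit trivial (by rintro ⟨_, _, h⟩; cases h) (.thm (.nec (.ipc .verum)))

theorem neg_imp {Γ : Set ModalForm} {A B : ModalForm}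
    (h : Der ∅ Γ (ModalForm.box (ModalForm.imp A B))) (hA : Pers true Γ A)
    (hB : Pers false Γ B) : Pers false Γ (ModalForm.imp A B) := by
  refine .neg ?_ ?_ ?_ <;> rintro _ rfl
  · rintro _ rfl
    exact h.weaken Set.subset_union_left
  · rintro E F hD
    cases hD
    exact hA.weaken Set.subset_union_left
  · rintro E F hD
    cases hD
    exact hB.weaken Set.subset_union_left

theorem neg_bigAnd {Γ : Set ModalForm} : ∀ {L : List ModalForm}, (∀ x ∈ L, Pers false Γ x) →
    Pers false Γ (bigAnd L)
  | [], _ => neg_top Γ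
  | [A], h => h A (by simp)
  | A :: _ :: _, h => neg_and (h A (by simp)) fun _ _ =>
      (neg_bigAnd fun x hx => h x (List.mem_cons_of_mem _ hx)).weaken Set.subset_union_left

/-- A member of a contracted disjunct is either a contracted member `D`, whose box comes from `□D`
and `□E`, or belongs to a disjunct of `F`, where the hereditary condition on consequents applies. -/
theorem contract {b : Bool} {Γ : Set ModalForm} {A E F : ModalForm} (h : Pers b Γ A)
    (hE : Der ∅ Γ (ModalForm.box E)) : Pers b Γ (contract E F A) := by
  induction h with
  | atom => exact .atom _ _
  | top => exact .top _
  | bot => exact .bot _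
  | box => exact .box _ _
  | and _ _ h₁ h₂ => exact .and (h₁ hE) (h₂ hE)
  | or _ _ h₁ h₂ => exact .or (h₁ hE) (h₂ hE)
  | imp _ hB h₁ h₂ =>
    rw [ModalForm.contract]
    split_ifs with hc
    · obtain ⟨rfl, rfl⟩ := hc
      exact hB
    · exact .imp (h₁ hE) (h₂ hE)
  | @neg Γ A a₁ a₂ a₃ h₁ h₂ =>
    have hE' Y : Der ∅ (Γ ∪ lits Y) (ModalForm.box E) := hE.weaken Set.subset_union_left
    have main : ∀ S ∈ sel (ModalForm.contract E F A), ∀ x ∈ S,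
        Der ∅ (Γ ∪ lits S) (ModalForm.box x) ∧ ∀ G H, x = ModalForm.imp G H →
          Pers true (Γ ∪ lits S) G ∧ Pers false (Γ ∪ lits S) H := by
      intro S hS x hx
      obtain ⟨Y, hY, hYS, hx'⟩ := sel_contract hS
      have sub : Γ ∪ lits Y ⊆ Γ ∪ lits S := Set.union_subset_union_right _ hYS
      rcases hx' x hx with ⟨D, hD, hDE, rfl, hD'⟩ | ⟨hEF, W, hW, hWS, hxW⟩
      · refine ⟨(Der.box_contract (hE' Y) (a₁ Y hY D hD)).weaken sub, fun G H hGH => ?_⟩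
        by_cases hDi : IsImp D
        · obtain ⟨U, V, rfl⟩ := hDi
          rw [ModalForm.contract, if_neg (by simpa using hDE)] at hGH
          cases hGH
          exact ⟨(h₁ Y hY U V hD (hE' Y)).weaken sub, (h₂ Y hY U V hD (hE' Y)).weaken sub⟩
        · rw [hD' hDi] at hGH
          exact (hDi ⟨G, H, hGH⟩).elim
      · have sub' : Γ ∪ lits Y ∪ lits W ⊆ Γ ∪ lits S :=
          Set.union_subset sub ((lits_mono hWS).trans Set.subset_union_right)
        cases a₃ Y hY E F hEF with
        | neg b₁ b₂ b₃ =>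
          refine ⟨(b₁ W hW x hxW).weaken sub', ?_⟩
          rintro G H rfl
          exact ⟨(b₂ W hW G H hxW).weaken sub', (b₃ W hW G H hxW).weaken sub'⟩
    exact .neg (fun S hS x hx => (main S hS x hx).1)
      (fun S hS G H hx => ((main S hS _ hx).2 G H rfl).1)
      (fun S hS G H hx => ((main S hS _ hx).2 G H rfl).2)

theorem bracket {Γ : Set ModalForm} {B A : ModalForm} (hB : Pers false Γ B) (hA : Pers true Γ A) :
    Pers true Γ (bracket B A) := by
  induction A with
  | atom | top | bot | box => exact hA
  | and _ _ h₁ h₂ => cases hA with | and a b => exact .and (h₁ a) (h₂ b)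
  | or _ _ h₁ h₂ => cases hA with | or a b => exact .or (h₁ a) (h₂ b)
  | imp => exact .imp hB hA

theorem bracketPrime {Γ : Set ModalForm} {B A : ModalForm} (hB : Pers false Γ B)
    (hA : Pers true Γ A) : Pers true Γ (bracketPrime B A) := by
  induction A with
  | atom | top | bot | box => exact hA
  | and _ _ h₁ h₂ => cases hA with | and a b => exact .and (h₁ a) (h₂ b)
  | or _ _ h₁ h₂ => cases hA with | or a b => exact .or (h₁ a) (h₂ b)
  | imp U V =>
    cases hA with
    | imp hU hV =>
      -- The conjuncts are swapped so that a disjunct of `U` comes first: its `lits` prove `□U`,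
      -- which is what contracting `B` needs. The order does not affect `sel`.
      refine .imp (neg_mono (A := ModalForm.and U (ModalForm.contract U V B)) ?_ ?_) hV
      · refine neg_and hU fun Y hY => (hB.weaken Set.subset_union_left).contract ?_
        cases hU with
        | neg a₁ _ _ => exact Der.box_of_sel hY (a₁ Y hY)
      · rintro _ ⟨Y, hY, Z, hZ, rfl⟩
        exact ⟨Z, hZ, Y, hY, Set.union_comm _ _⟩

theorem bigOr_map {Γ : Set ModalForm} {f : ModalForm → ModalForm} : ∀ {L : List ModalForm},
    (∀ x ∈ L, Pers true Γ (f x)) → Pers true Γ (bigOr (L.map f))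
  | [], _ => .bot _
  | [A], h => h A (by simp)
  | A :: _ :: _, h => .or (h A (by simp)) (bigOr_map fun x hx => h x (List.mem_cons_of_mem _ hx))

theorem fill {Γ : Set ModalForm} {A B : ModalForm} (h : Pers true Γ A → Pers true Γ B) :
    ∀ {J : OuterCtx}, Pers true Γ (J.fill A) → Pers true Γ (J.fill B)
  | .hole, hJ => h hJ
  | .andL _ _, .and a b => .and (fill h a) b
  | .andR _ _, .and a b => .and a (fill h b)
  | .orL _ _, .or a b => .or (fill h a) b
  | .orR _ _, .or a b => .or a (fill h b)

/-- Invariance when `p` is split off the antecedent: it is lost from `lits`, but the new context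
proves it. With `p = ⊤` the context need not change. -/
theorem neg_erase {Γ Δ : Set ModalForm} {B p : ModalForm} (hB : ¬ HasOuterOr B)
    (h : Pers false Γ B) (hΓ : ∀ x ∈ Γ, Der ∅ Δ x) (hp : Der ∅ Δ p) :
    Pers false Δ (bigAnd ((conjuncts B).erase p)) := by
  have hs := sel_of_not_hasOuterOr hB
  have hmem : ∀ x ∈ (conjuncts B).erase p, x ∈ conjunctList B := fun x hx =>
    List.mem_dedup.1 (List.mem_of_mem_erase hx)
  have hl : ∀ x ∈ (conjuncts B).erase p, IsLit x := fun x hx =>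
    isLit_of_mem_conjunctList hB (hmem x hx)
  have hc : ∀ S ∈ sel (bigAnd ((conjuncts B).erase p)),
      ∀ x ∈ Γ ∪ lits {x | x ∈ conjunctList B}, Der ∅ (Δ ∪ lits S) x := by
    rintro S hS x (hx | ⟨hx, hx'⟩)
    · exact (hΓ x hx).weaken Set.subset_union_left
    -- Every non-implicational conjunct other than `p` survives the erasure.
    · by_cases hxp : x = p
      · exact (hxp ▸ hp).weaken Set.subset_union_left
      · exact .hyp (.inr ⟨(sel_bigAnd hl hS).1 x ((List.mem_erase_of_ne hxp).2
          (List.mem_dedup.2 hx)), hx'⟩)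
  have hS : ∀ S ∈ sel (bigAnd ((conjuncts B).erase p)), ∀ x ∈ S,
      x ∈ conjunctList B ∨ x = ModalForm.top := fun S hS x hx =>
    ((sel_bigAnd hl hS).2 x hx).imp_left (hmem x)
  cases h with
  | neg a₁ a₂ a₃ =>
    refine .neg (fun S h x hx => ?_) (fun S h E F hx => ?_) (fun S h E F hx => ?_)
    · rcases hS S h x hx with hx | rfl
      · exact (a₁ _ (hs ▸ rfl) x hx).cut (hc S h)
      · exact .thm (.nec (.ipc .verum))
    · rcases hS S h _ hx with hx | hx
      · exact (a₂ _ (hs ▸ rfl) E F hx).cut (hc S h)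
      · cases hx
    · rcases hS S h _ hx with hx | hx
      · exact (a₃ _ (hs ▸ rfl) E F hx).cut (hc S h)
      · cases hx

/-- Without outer disjunctions `B` has a single disjunct, and its `lits` is empty when all conjuncts
are implications; so `Γ` alone proves the boxes. -/
theorem of_conjuncts {Γ : Set ModalForm} {B : ModalForm} (hB : ¬ HasOuterOr B)
    (h : Pers false Γ B) (hi : ∀ D ∈ conjuncts B, IsImp D) {E F : ModalForm}
    (hEF : ModalForm.imp E F ∈ conjuncts B) :
    Der ∅ Γ (ModalForm.box (ModalForm.imp E F)) ∧ Pers true Γ E ∧ Pers false Γ F := by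
  have hs := sel_of_not_hasOuterOr hB
  have hsub : Γ ∪ lits {x | x ∈ conjunctList B} ⊆ Γ := by
    rintro x (hx | ⟨hx, hx'⟩)
    · exact hx
    · exact (hx' (hi x (List.mem_dedup.2 hx))).elim
  have hm : ModalForm.imp E F ∈ conjunctList B := List.mem_dedup.1 hEF
  cases h with
  | neg a₁ a₂ a₃ =>
    exact ⟨(a₁ _ (hs ▸ rfl) _ hm).weaken hsub, (a₂ _ (hs ▸ rfl) _ _ hm).weaken hsub,
      (a₃ _ (hs ▸ rfl) _ _ hm).weaken hsub⟩

end Pers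

/-- The translation places `□p` next to `p` and `□(A^□ → B^□)` next to the implication. These boxes
lie in `lits`, and axiom 4 gives the boxes of the boxes themselves. Both polarities are proved
together because `imp` exchanges them, and for all contexts because `lits` enlarges the context. -/
theorem pers_boxTr (A : ModalForm) : ∀ Γ, Pers true Γ A.boxTr ∧ Pers false Γ A.boxTr := by
  induction A with
  | atom n =>
    refine fun Γ => ⟨.and (.atom _ _) (.box _ _), .neg ?_ ?_ ?_⟩ <;>
      rintro _ ⟨_, rfl, _, rfl, rfl⟩
    · have h : Der ∅ (Γ ∪ lits ({atom n} ∪ {box (atom n)})) (box (atom n)) :=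
        .hyp (.inr ⟨.inr rfl, by rintro ⟨_, _, h⟩; cases h⟩)
      rintro _ (rfl | rfl)
      · exact h
      · exact h.box_box
    · rintro E F (h | h) <;> cases h
    · rintro E F (h | h) <;> cases h
  | top => exact fun Γ => ⟨.top _, Pers.neg_top _⟩
  | bot => exact fun Γ => ⟨.bot _, Pers.neg_of_isLit trivial (by rintro ⟨_, _, h⟩; cases h)
      (Der.head.botE)⟩
  | and A B hA hB => exact fun Γ => ⟨.and (hA Γ).1 (hB Γ).1, (hA Γ).2.neg_and fun Y _ => (hB _).2⟩
  | or A B hA hB => exact fun Γ => ⟨.or (hA Γ).1 (hB Γ).1, (hA Γ).2.neg_or (hB _).2⟩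
  | imp A B hA hB =>
    refine fun Γ => ⟨.and (.imp (hA Γ).2 (hB Γ).1) (.box _ _), .neg ?_ ?_ ?_⟩ <;>
      rintro _ ⟨_, rfl, _, rfl, rfl⟩
    · have h : Der ∅ (Γ ∪ lits ({imp A.boxTr B.boxTr} ∪ {box (imp A.boxTr B.boxTr)}))
          (box (imp A.boxTr B.boxTr)) :=
        .hyp (.inr ⟨.inr rfl, by rintro ⟨_, _, h⟩; cases h⟩)
      rintro _ (rfl | rfl)
      · exact h
      · exact h.box_box
    · rintro E F (h | h)
      · cases h; exact (hA _).1
      · cases h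
    · rintro E F (h | h)
      · cases h; exact (hB _).2
      · cases h
  | box A _ =>
    exact fun Γ => ⟨.box _ _, Pers.neg_of_isLit trivial (by rintro ⟨_, _, h⟩; cases h)
      (Der.head.box_box)⟩

/-! ### Soundness of the NNIL-algorithm -/

theorem imp_consequent {D : ModalForm} (h : IsImp D) : imp (antecedent D) (consequent D) = D := by
  obtain ⟨E, F, rfl⟩ := h
  rfl

theorem mem_goalSet {X : List ModalForm} {C x : ModalForm} :
    x ∈ goalSet X C ↔ (∃ D ∈ X, antecedent D = x) ∨ x = C := by
  simp [goalSet]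

theorem mem_down {X : List ModalForm} {D x : ModalForm} :
    x ∈ (X.erase D).insert (consequent D) ↔ x = consequent D ∨ x ∈ X.erase D :=
  List.mem_insert_iff

namespace Der

variable {T Γ : Set ModalForm} {B C : ModalForm} {X : List ModalForm}

theorem iff_of_conjuncts (hX : X = conjuncts B ∨ B = top ∧ X = []) :
    Der T Γ B ↔ ∀ x ∈ X, Der T Γ x := by
  rcases hX with rfl | ⟨rfl, rfl⟩
  · exact conjuncts_iff
  · simp [topI]

/-- `B ↓ D` strengthens `D = (E → F)` to `F`; conversely, `down_of` recovers `F` from `B` and `E`.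
-/
theorem of_down {D : ModalForm} (hX : X = conjuncts B ∨ B = top ∧ X = []) (hD : D ∈ X)
    (hi : IsImp D) (h : Der T Γ (down X D)) : Der T Γ B := by
  have h' := bigAnd_iff.1 h
  refine (iff_of_conjuncts hX).2 fun x hx => ?_
  by_cases hxD : x = D
  · subst hxD
    rw [← imp_consequent hi]
    exact (h' _ (mem_down.2 (.inl rfl))).insert.impI
  · exact h' x (mem_down.2 (.inr ((List.mem_erase_of_ne hxD).2 hx)))

theorem down_of {D : ModalForm} (hX : X = conjuncts B ∨ B = top ∧ X = []) (hD : D ∈ X)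
    (hi : IsImp D) (h : Der T Γ B) (hE : Der T Γ (antecedent D)) : Der T Γ (down X D) := by
  have h' := (iff_of_conjuncts hX).1 h
  refine bigAnd_iff.2 fun x hx => ?_
  rcases mem_down.1 hx with rfl | hx
  · exact mp (by rw [imp_consequent hi]; exact h' D hD) hE
  · exact h' x (List.mem_of_mem_erase hx)

/-- Given `B`, a disjunct of `[B]Z` or `[B]'Z` yields `C` directly or the antecedent of some `D ∈
X`; in the latter case `B ↓ D` holds and hence `C`. -/
theorem of_goalSet {g : ModalForm → ModalForm} (hX : X = conjuncts B ∨ B = top ∧ X = [])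
    (hi : ∀ D ∈ X, IsImp D) (hB : Der T Γ B)
    (hf : ∀ D ∈ X, Der T Γ (imp (down X D) C)) (h : Der T Γ (bigOr ((goalSet X C).map g)))
    (hg : ∀ (x : ModalForm) {Γ' : Set ModalForm}, Der T Γ' B → Der T Γ' (g x) → Der T Γ' x) :
    Der T Γ C := by
  refine bigOr_elim h fun y hy => ?_
  obtain ⟨x, hx, rfl⟩ := List.mem_map.1 hy
  have hx' := hg x hB.insert (head (A := g x))
  rcases mem_goalSet.1 hx with ⟨D, hD, rfl⟩ | rfl
  · exact (hf D hD).insert.mp (down_of hX hD (hi D hD) hB.insert hx')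
  · exact hx'

theorem of_star {A R : ModalForm} (h : Star A R) {Γ : Set ModalForm} (hR : Der T Γ R) :
    Der T Γ A := by
  induction h generalizing Γ with
  | atom | top | bot | box => exact hR
  | and _ _ h₁ h₂ => exact andI (h₁ hR.andL) (h₂ hR.andR)
  | or _ _ h₁ h₂ => exact orE hR (orL (h₁ head)) (orR (h₂ head))
  | impAnd B J D E _ _ h₁ h₂ =>
    exact impI (fill_and J ((h₁ hR.andL).insert.mp head) ((h₂ hR.andR).insert.mp head))
  | impOr C J D E _ _ h₁ h₂ =>
    exact impI (orE (fill_or J head) ((h₁ hR.andL).insert.insert.mp head)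
      ((h₂ hR.andR).insert.insert.mp head))
  | impAtom B C p _ _ hp _ _ h₁ =>
    have hB := conjuncts_iff.1 (head (T := T) (Γ := Γ) (A := B))
    exact impI ((h₁ (hR.insert.mp (hB p hp))).mp
      (bigAnd_iff.2 fun x hx => hB x (List.mem_of_mem_erase hx)))
  | impTop B C _ _ hp _ _ h₁ =>
    exact impI ((h₁ hR.insert).mp (bigAnd_iff.2 fun x hx =>
      conjuncts_iff.1 head x (List.mem_of_mem_erase hx)))
  | impBot B C _ _ hp => exact impI (botE (conjuncts_iff.1 head _ hp))
  | impImps B C X f _ _ hX hi _ _ _ h₁ h₂ =>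
    exact impI (of_goalSet hX hi head
      (fun D hD => h₁ D hD (bigAnd_iff.1 hR.andL.insert _ (List.mem_map_of_mem hD)))
      (h₂ hR.andR.insert) fun x _ => of_bracket x)
  | impImpsPrime B C X f _ _ hX hi _ _ _ h₁ h₂ =>
    exact impI (of_goalSet hX hi head
      (fun D hD => h₁ D hD (bigAnd_iff.1 hR.andL.insert _ (List.mem_map_of_mem hD)))
      (h₂ hR.andR.insert) fun x _ => of_bracketPrime x)

end Der

/-! ### Preservation: `γ ∧ A ▶* A^*` for persistent `A` -/

theorem Pres.of_der {A B : ModalForm} (h : Der ∅ {A} B) : Pres A B := .a1 h.toImp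

theorem Pres.bigAnd {A : ModalForm} : ∀ {L : List ModalForm}, (∀ x ∈ L, Pres A x) →
    Pres A (bigAnd L)
  | [], _ => .of_der .topI
  | [B], h => h B (by simp)
  | B :: _ :: _, h => .a3 (h B (by simp)) (Pres.bigAnd fun x hx => h x (List.mem_cons_of_mem _ hx))

/-- Rule (B2) for the algorithm's data: `B` may be bracketed differently from `⋀ X` or repeat
conjuncts, and both are only equivalent, which `Der.bracket_mono` absorbs inside the bracket. -/
theorem Pres.bracketSet {B C : ModalForm} {X : List ModalForm}
    (hX : X = conjuncts B ∨ B = top ∧ X = []) (hi : ∀ D ∈ X, IsImp D) :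
    Pres (and (imp B C) (box B)) (bracketSet B (goalSet X C)) := by
  have hmap : (X.map fun D => (antecedent D, consequent D)).map (fun x => imp x.1 x.2) = X := by
    rw [List.map_map]
    exact (List.map_congr_left fun D hD => imp_consequent (hi D hD)).trans (List.map_id X)
  have e {Γ : Set ModalForm} : Der ∅ Γ B ↔ Der ∅ Γ (ModalForm.bigAnd X) :=
    (Der.iff_of_conjuncts hX).trans Der.bigAnd_iff.symm
  refine .a2 (.of_der (Der.andI (A := imp (ModalForm.bigAnd X) C)
    (B := box (ModalForm.bigAnd X)) ?_ ?_)) (.a2 (.b2 (X.map fun D => (antecedent D, consequent D))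
    (ModalForm.bigAnd X) C (by rw [hmap])) (.of_der ?_))
  · exact Der.impI (Der.self.andL.insert.mp (e.2 Der.head))
  · exact Der.box_mono (Der.toImp (e.1 Der.self)) Der.self.andR
  · refine Der.bigOr_elim Der.self fun y hy => ?_
    obtain ⟨x, hx, rfl⟩ := List.mem_map.1 hy
    refine Der.bigOr_intro (List.mem_map_of_mem (mem_goalSet.2 (?_ : _ ∨ x = C)))
      (Der.bracket_mono x (Der.impI (e.1 Der.head)) Der.head)
    simpa using hx

namespace Pers

variable {Γ : Set ModalForm} {B C : ModalForm} {X : List ModalForm}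

theorem of_mem (hX : X = conjuncts B ∨ B = ModalForm.top ∧ X = []) (hi : ∀ D ∈ X, IsImp D)
    (hO : ¬ HasOuterOr B) (hB : Pers false Γ B) {D : ModalForm} (hD : D ∈ X) :
    Der ∅ Γ (ModalForm.box D) ∧ Pers true Γ (antecedent D) ∧ Pers false Γ (consequent D) := by
  rcases hX with rfl | ⟨_, rfl⟩
  · obtain ⟨E, F, rfl⟩ := hi D hD
    exact of_conjuncts hO hB hi hD
  · cases hD

theorem goalSet (hX : X = conjuncts B ∨ B = ModalForm.top ∧ X = []) (hi : ∀ D ∈ X, IsImp D)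
    (hO : ¬ HasOuterOr B) (hB : Pers false Γ B) (hC : Pers true Γ C) :
    ∀ x ∈ goalSet X C, Pers true Γ x := by
  intro x hx
  rcases mem_goalSet.1 hx with ⟨D, hD, rfl⟩ | rfl
  · exact (of_mem hX hi hO hB hD).2.1
  · exact hC

theorem down (hX : X = conjuncts B ∨ B = ModalForm.top ∧ X = []) (hi : ∀ D ∈ X, IsImp D)
    (hO : ¬ HasOuterOr B) (hB : Pers false Γ B) {D : ModalForm} (hD : D ∈ X) :
    Pers false Γ (down X D) := by
  refine neg_bigAnd fun x hx => ?_
  rcases mem_down.1 hx with rfl | hx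
  · exact (of_mem hX hi hO hB hD).2.2
  · have hx' := List.mem_of_mem_erase hx
    have := of_mem hX hi hO hB hx'
    obtain ⟨E, F, rfl⟩ := hi x hx'
    exact neg_imp this.1 this.2.1 this.2.2

theorem box_of_conjuncts (hX : X = conjuncts B ∨ B = ModalForm.top ∧ X = [])
    (hi : ∀ D ∈ X, IsImp D) (hO : ¬ HasOuterOr B) (hB : Pers false Γ B) :
    Der ∅ Γ (ModalForm.box B) := by
  refine Der.box_mono (A := bigAnd X) (Der.toImp ?_)
    (Der.box_bigAnd fun D hD => (of_mem hX hi hO hB hD).1)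
  exact (Der.iff_of_conjuncts hX).2 (Der.bigAnd_iff.1 Der.self)

end Pers

theorem Pres.impImps {γ B C R : ModalForm} {X : List ModalForm} {f : ModalForm → ModalForm}
    (hX : X = conjuncts B ∨ B = top ∧ X = []) (hi : ∀ D ∈ X, IsImp D) (hO : ¬ HasOuterOr B)
    (hB : Pers false {γ} B)
    (hf : ∀ D ∈ X, Pres (and γ (imp (down X D) C)) (f D))
    (hR : Pres (and γ (ModalForm.bracketSet B (goalSet X C))) R) :
    Pres (and γ (imp B C)) (and (ModalForm.bigAnd (X.map f)) R) := by
  -- `γ` supplies the `□B` required by (B2), and (A3) keeps a copy of `γ` for the recursive call on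
  -- the bracket.
  refine .a3 (Pres.bigAnd ?_) (.a2 (.a3 (.of_der Der.self.andL) (.a2 (.of_der (Der.andI
    Der.self.andR ?_)) (Pres.bracketSet hX hi))) hR)
  · intro y hy
    obtain ⟨D, hD, rfl⟩ := List.mem_map.1 hy
    refine .a2 (.of_der (Der.andI Der.self.andL (Der.impI ?_))) (hf D hD)
    exact Der.self.andR.insert.mp (Der.of_down hX hD (hi D hD) Der.head)
  · exact (Pers.box_of_conjuncts hX hi hO hB).cut fun x hx => by
      rw [Set.mem_singleton_iff.1 hx]; exact Der.self.andL

/-- The formula `γ` accumulates the atoms and boxes split off so far and varies in the induction;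
each case pairs a rule of `▶*` with the invariance of `Pers` under the corresponding step. -/
theorem Pres.of_star {A R : ModalForm} (h : Star A R) {γ : ModalForm} (hA : Pers true {γ} A) :
    Pres (and γ A) R := by
  induction h generalizing γ with
  | atom | top | bot | box => exact .of_der Der.self.andR
  | and _ _ h₁ h₂ =>
    cases hA with
    | and a b =>
      exact .a3 (.a2 (.of_der (Der.andI Der.self.andL Der.self.andR.andL)) (h₁ a))
        (.a2 (.of_der (Der.andI Der.self.andL Der.self.andR.andR)) (h₂ b))
  | @or B C _ _ _ _ h₁ h₂ =>
    cases hA with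
    | or a b =>
      refine .a2 (.of_der (B := or (and γ B) (and γ C)) ?_)
        (.b1 (.a2 (h₁ a) (.of_der Der.self.orL)) (.a2 (h₂ b) (.of_der Der.self.orR)))
      exact Der.orE Der.self.andR (Der.orL (Der.andI Der.self.andL.insert Der.head))
        (Der.orR (Der.andI Der.self.andL.insert Der.head))
  | impAnd B J D E _ _ h₁ h₂ =>
    cases hA with
    | imp a b =>
      have b₁ := b.fill (B := D) fun h => by cases h with | and h _ => exact h
      have b₂ := b.fill (B := E) fun h => by cases h with | and _ h => exact h
      refine .a3 (.a2 (.of_der (Der.andI Der.self.andL (Der.impI ?_))) (h₁ (.imp a b₁)))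
        (.a2 (.of_der (Der.andI Der.self.andL (Der.impI ?_))) (h₂ (.imp a b₂)))
      · exact Der.fill_mono J (Der.self.andR.insert.mp Der.head) (Der.ipc (.andLeft _ _))
      · exact Der.fill_mono J (Der.self.andR.insert.mp Der.head) (Der.ipc (.andRight _ _))
  | impOr C J D E _ _ h₁ h₂ =>
    cases hA with
    | imp a b =>
      have a₁ := a.neg_mono (sel_fill_mono (A := D) (B := or D E) Set.subset_union_left J)
      have a₂ := a.neg_mono (sel_fill_mono (A := E) (B := or D E) Set.subset_union_right J)
      refine .a3 (.a2 (.of_der (Der.andI Der.self.andL (Der.impI ?_))) (h₁ (.imp a₁ b)))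
        (.a2 (.of_der (Der.andI Der.self.andL (Der.impI ?_))) (h₂ (.imp a₂ b)))
      · exact Der.self.andR.insert.mp (Der.fill_mono J Der.head (Der.ipc (.orLeft _ _)))
      · exact Der.self.andR.insert.mp (Der.fill_mono J Der.head (Der.ipc (.orRight _ _)))
  | impAtom B C p _ hO hp hp' _ h₁ =>
    cases hA with
    | imp a b =>
      have hγ : ∀ x ∈ ({γ} : Set ModalForm), Der ∅ {and γ p} x := fun x hx => by
        rw [Set.mem_singleton_iff.1 hx]; exact Der.self.andL
      -- The induction hypothesis is used with `γ ∧ p` in place of `γ`; (B3) then restores the guard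
      -- `p →`.
      refine .a2 (.of_der ?_) (.b3 hp' (h₁ (.imp (a.neg_erase hO hγ Der.self.andR) (b.cut hγ))))
      refine Der.impI (Der.andI (Der.andI Der.self.andL.insert Der.head) (Der.impI ?_))
      refine Der.self.andR.insert.insert.mp (Der.conjuncts_iff.2 fun x hx => ?_)
      by_cases hxp : x = p
      · exact hxp ▸ Der.head.insert
      · exact Der.bigAnd_iff.1 Der.head x ((List.mem_erase_of_ne hxp).2 hx)
  | impTop B C _ hO _ _ _ h₁ =>
    cases hA with
    | imp a b =>
      have hγ : ∀ x ∈ ({γ} : Set ModalForm), Der ∅ {γ} x := fun x hx => .hyp hx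
      refine .a2 (.of_der (Der.andI Der.self.andL (Der.impI ?_)))
        (h₁ (.imp (a.neg_erase hO hγ Der.topI) b))
      refine Der.self.andR.insert.mp (Der.conjuncts_iff.2 fun x hx => ?_)
      by_cases hxp : x = top
      · exact by rw [hxp]; exact Der.topI
      · exact Der.bigAnd_iff.1 Der.head x ((List.mem_erase_of_ne hxp).2 hx)
  | impBot => exact .of_der Der.topI
  | impImps B C X f _ hO hX hi _ _ _ h₁ h₂ =>
    cases hA with
    | imp a b =>
      exact Pres.impImps hX hi hO a (fun D hD => h₁ D hD (.imp (.down hX hi hO a hD) b))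
        (h₂ (.bigOr_map fun x hx => .bracket a (.goalSet hX hi hO a b x hx)))
  | impImpsPrime B C X f _ hO hX hi _ _ _ h₁ h₂ =>
    cases hA with
    | imp a b =>
      refine Pres.impImps hX hi hO a (fun D hD => h₁ D hD (.imp (.down hX hi hO a hD) b))
        -- Since `[B]Z → [B]'Z` is derivable, (B2) serves this case as well.
        (.a2 (.of_der (Der.andI Der.self.andL ?_))
          (h₂ (.bigOr_map fun x hx => .bracketPrime a (.goalSet hX hi hO a b x hx))))
      exact Der.bigOr_map Der.self.andR fun x _ => Der.bracketPrime_of_bracket x Der.head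

/-! ### Outer boxes of the output -/

theorem outerBoxes_fill_mono {A B : ModalForm} (h : outerBoxes A ⊆ outerBoxes B) :
    ∀ J : OuterCtx, outerBoxes (J.fill A) ⊆ outerBoxes (J.fill B)
  | .hole => h
  | .andL J _ | .orL J _ => Set.union_subset_union_left _ (outerBoxes_fill_mono h J)
  | .andR _ J | .orR _ J => Set.union_subset_union_right _ (outerBoxes_fill_mono h J)

theorem outerBoxes_bigAnd {S : Set ModalForm} : ∀ {L : List ModalForm},
    (∀ x ∈ L, outerBoxes x ⊆ S) → outerBoxes (bigAnd L) ⊆ S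
  | [], _ => Set.empty_subset _
  | [A], h => h A (by simp)
  | A :: _ :: _, h => Set.union_subset (h A (by simp))
      (outerBoxes_bigAnd fun x hx => h x (List.mem_cons_of_mem _ hx))

theorem outerBoxes_bigOr {S : Set ModalForm} : ∀ {L : List ModalForm},
    (∀ x ∈ L, outerBoxes x ⊆ S) → outerBoxes (bigOr L) ⊆ S
  | [], _ => Set.empty_subset _
  | [A], h => h A (by simp)
  | A :: _ :: _, h => Set.union_subset (h A (by simp))
      (outerBoxes_bigOr fun x hx => h x (List.mem_cons_of_mem _ hx))

theorem outerBoxes_of_mem_conjunctList : ∀ {B x : ModalForm}, x ∈ conjunctList B →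
    outerBoxes x ⊆ outerBoxes B
  | and _ _, _, hx => (List.mem_append.1 hx).elim
      (fun h => (outerBoxes_of_mem_conjunctList h).trans Set.subset_union_left)
      (fun h => (outerBoxes_of_mem_conjunctList h).trans Set.subset_union_right)
  | .or _ _, _, hx | .atom _, _, hx | .top, _, hx | .bot, _, hx | .imp _ _, _, hx
  | .box _, _, hx => by
    simp only [conjunctList, List.mem_singleton] at hx
    rw [hx]

theorem outerBoxes_of_mem_conjuncts {B x : ModalForm} (h : x ∈ conjuncts B) :
    outerBoxes x ⊆ outerBoxes B :=
  outerBoxes_of_mem_conjunctList (List.mem_dedup.1 h)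

theorem outerBoxes_contract {E F : ModalForm} : ∀ A : ModalForm,
    outerBoxes (contract E F A) ⊆ outerBoxes A
  | .atom _ | .top | .bot | .box _ => subset_rfl
  | .and A B | .or A B => Set.union_subset_union (outerBoxes_contract A) (outerBoxes_contract B)
  | .imp A B => by
    rw [contract]
    split_ifs with hc
    · obtain ⟨rfl, rfl⟩ := hc
      exact Set.subset_union_right
    · exact Set.union_subset_union (outerBoxes_contract A) (outerBoxes_contract B)

theorem outerBoxes_bracket {B : ModalForm} : ∀ A : ModalForm,
    outerBoxes (bracket B A) ⊆ outerBoxes B ∪ outerBoxes A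
  | .atom _ | .top | .bot | .box _ | .imp _ _ => by simp [bracket, outerBoxes]
  | .and A A' | .or A A' => Set.union_subset
      ((outerBoxes_bracket A).trans (Set.union_subset_union_right _ Set.subset_union_left))
      ((outerBoxes_bracket A').trans (Set.union_subset_union_right _ Set.subset_union_right))

theorem outerBoxes_bracketPrime {B : ModalForm} : ∀ A : ModalForm,
    outerBoxes (bracketPrime B A) ⊆ outerBoxes B ∪ outerBoxes A
  | .atom _ | .top | .bot | .box _ => by simp [bracketPrime, outerBoxes]
  | .imp U V => Set.union_subset
      (Set.union_subset_union (outerBoxes_contract B) Set.subset_union_left)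
      ((Set.subset_union_right (s := outerBoxes U)).trans Set.subset_union_right)
  | .and A A' | .or A A' => Set.union_subset
      ((outerBoxes_bracketPrime A).trans (Set.union_subset_union_right _ Set.subset_union_left))
      ((outerBoxes_bracketPrime A').trans (Set.union_subset_union_right _ Set.subset_union_right))

section

variable {B C : ModalForm} {X : List ModalForm}

theorem outerBoxes_of_mem (hX : X = conjuncts B ∨ B = top ∧ X = []) {D : ModalForm} (hD : D ∈ X) :
    outerBoxes D ⊆ outerBoxes B := by
  rcases hX with rfl | ⟨_, rfl⟩
  · exact outerBoxes_of_mem_conjuncts hD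
  · cases hD

theorem outerBoxes_antecedent : ∀ D : ModalForm, outerBoxes (antecedent D) ⊆ outerBoxes D
  | .imp _ _ => Set.subset_union_left
  | .atom _ | .top | .bot | .box _ | .and _ _ | .or _ _ => subset_rfl

theorem outerBoxes_consequent : ∀ D : ModalForm, outerBoxes (consequent D) ⊆ outerBoxes D
  | .imp _ _ => Set.subset_union_right
  | .atom _ | .top | .bot | .box _ | .and _ _ | .or _ _ => subset_rfl

theorem outerBoxes_down (hX : X = conjuncts B ∨ B = top ∧ X = []) {D : ModalForm} (hD : D ∈ X) :
    outerBoxes (down X D) ⊆ outerBoxes B := by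
  refine outerBoxes_bigAnd fun x hx => ?_
  rcases mem_down.1 hx with rfl | hx
  · exact (outerBoxes_consequent D).trans (outerBoxes_of_mem hX hD)
  · exact outerBoxes_of_mem hX (List.mem_of_mem_erase hx)

theorem outerBoxes_goalSet (hX : X = conjuncts B ∨ B = top ∧ X = []) :
    ∀ x ∈ goalSet X C, outerBoxes B ∪ outerBoxes x ⊆ outerBoxes (imp B C) := by
  intro x hx
  rcases mem_goalSet.1 hx with ⟨D, hD, rfl⟩ | rfl
  · exact Set.union_subset Set.subset_union_left
      (((outerBoxes_antecedent D).trans (outerBoxes_of_mem hX hD)).trans Set.subset_union_left)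
  · exact subset_rfl

end

theorem outerBoxes_star {A R : ModalForm} (h : Star A R) : outerBoxes R ⊆ outerBoxes A := by
  induction h with
  | atom | top | bot | box => exact subset_rfl
  | and _ _ h₁ h₂ | or _ _ h₁ h₂ => exact Set.union_subset_union h₁ h₂
  | impAnd B J D E _ _ h₁ h₂ =>
    exact Set.union_subset
      (h₁.trans (Set.union_subset_union_right _ (outerBoxes_fill_mono Set.subset_union_left J)))
      (h₂.trans (Set.union_subset_union_right _ (outerBoxes_fill_mono Set.subset_union_right J)))
  | impOr C J D E _ _ h₁ h₂ =>
    exact Set.union_subset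
      (h₁.trans (Set.union_subset_union_left _ (outerBoxes_fill_mono Set.subset_union_left J)))
      (h₂.trans (Set.union_subset_union_left _ (outerBoxes_fill_mono Set.subset_union_right J)))
  | impAtom B C p _ _ hp _ _ h₁ =>
    exact Set.union_subset ((outerBoxes_of_mem_conjuncts hp).trans Set.subset_union_left)
      (h₁.trans (Set.union_subset_union_left _ (outerBoxes_bigAnd fun x hx =>
        outerBoxes_of_mem_conjuncts (List.mem_of_mem_erase hx))))
  | impTop B C _ _ _ _ _ h₁ =>
    exact h₁.trans (Set.union_subset_union_left _ (outerBoxes_bigAnd fun x hx =>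
        outerBoxes_of_mem_conjuncts (List.mem_of_mem_erase hx)))
  | impBot => exact Set.empty_subset _
  | impImps B C X f _ _ hX _ _ _ _ h₁ h₂ =>
    refine Set.union_subset (outerBoxes_bigAnd fun y hy => ?_) (h₂.trans (outerBoxes_bigOr
      fun y hy => ?_)) <;> obtain ⟨x, hx, rfl⟩ := List.mem_map.1 hy
    · exact (h₁ x hx).trans (Set.union_subset_union_left _ (outerBoxes_down hX hx))
    · exact (outerBoxes_bracket x).trans (outerBoxes_goalSet hX x hx)
  | impImpsPrime B C X f _ _ hX _ _ _ _ h₁ h₂ =>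
    refine Set.union_subset (outerBoxes_bigAnd fun y hy => ?_) (h₂.trans (outerBoxes_bigOr
      fun y hy => ?_)) <;> obtain ⟨x, hx, rfl⟩ := List.mem_map.1 hy
    · exact (h₁ x hx).trans (Set.union_subset_union_left _ (outerBoxes_down hX hx))
    · exact (outerBoxes_bracketPrime x).trans (outerBoxes_goalSet hX x hx)

/-! ### Termination of the NNIL-algorithm -/

theorem connCount_le_of_mem_imps {E A : ModalForm} (h : E ∈ imps A) : connCount E ≤ connCount A := by
  induction A with
  | atom | top | bot | box => simp [imps] at h
  | and A B h₁ h₂ | or A B h₁ h₂ =>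
    simp only [imps, Finset.mem_union] at h
    simp only [connCount]
    rcases h with h | h
    · have := h₁ h; omega
    · have := h₂ h; omega
  | imp A B h₁ h₂ =>
    simp only [imps, Finset.mem_union, Finset.mem_insert] at h
    rcases h with rfl | h | h
    · exact le_rfl
    · have := h₁ h; simp only [connCount]; omega
    · have := h₂ h; simp only [connCount]; omega

theorem imps_subset_of_mem {E A : ModalForm} (h : E ∈ imps A) : imps E ⊆ imps A := by
  induction A with
  | atom | top | bot | box => simp [imps] at h
  | and A B h₁ h₂ | or A B h₁ h₂ =>
    simp only [imps, Finset.mem_union] at h ⊢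
    exact h.elim (fun h => (h₁ h).trans Finset.subset_union_left)
      (fun h => (h₂ h).trans Finset.subset_union_right)
  | imp A B h₁ h₂ =>
    simp only [imps, Finset.mem_union, Finset.mem_insert] at h ⊢
    rcases h with rfl | h | h
    · exact subset_rfl
    · exact ((h₁ h).trans Finset.subset_union_left).trans (Finset.subset_insert _ _)
    · exact ((h₂ h).trans Finset.subset_union_right).trans (Finset.subset_insert _ _)

theorem imp_notMem_imps_left {A B : ModalForm} : imp A B ∉ imps A := fun h => by
  have := connCount_le_of_mem_imps h
  simp only [connCount] at this
  omega

theorem imp_notMem_imps_right {A B : ModalForm} : imp A B ∉ imps B := fun h => by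
  have := connCount_le_of_mem_imps h
  simp only [connCount] at this
  omega

theorem impRank_mono {A B : ModalForm} (h : imps A ⊆ imps B) : impRank A ≤ impRank B :=
  Finset.sup_mono h

/-- The maximum is attained at the whole implication, which by its size is not a subformula of
either side. -/
theorem impRank_imp (A B : ModalForm) : impRank (imp A B) = (imps A ∪ imps B).card + 1 := by
  have hc : (imps (imp A B)).card = (imps A ∪ imps B).card + 1 := by
    rw [imps, Finset.card_insert_of_notMem]
    simp [imp_notMem_imps_left, imp_notMem_imps_right]
  rw [← hc]
  refine le_antisymm (Finset.sup_le fun E hE => Finset.card_le_card (imps_subset_of_mem hE)) ?_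
  exact Finset.le_sup (f := fun E => (imps E).card) (by simp [imps])

theorem complexityLT_of_subset {A B : ModalForm} (h : imps A ⊆ imps B)
    (hc : connCount A < connCount B) : ComplexityLT A B :=
  (impRank_mono h).lt_or_eq.imp id fun h => ⟨h, hc⟩

theorem complexityLT_imp {A B A' B' : ModalForm} (hA : imps A ⊆ imps A') (hB : imps B ⊆ imps B')
    (hc : connCount A + connCount B < connCount A' + connCount B') :
    ComplexityLT (imp A B) (imp A' B') := by
  have hr : impRank (imp A B) ≤ impRank (imp A' B') := by
    rw [impRank_imp, impRank_imp]
    exact Nat.succ_le_succ (Finset.card_le_card (Finset.union_subset_union hA hB))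
  refine hr.lt_or_eq.imp id fun h => ⟨h, ?_⟩
  simp only [connCount]
  omega

theorem complexityLT_wf : WellFounded ComplexityLT := by
  refine Subrelation.wf (r := InvImage (Prod.Lex (· < ·) (· < ·))
    fun A => (impRank A, connCount A)) ?_
    (InvImage.wf _ (WellFounded.prod_lex wellFounded_lt wellFounded_lt))
  intro A B h
  exact Prod.lex_def.2 h

theorem imps_fill_mono {A B : ModalForm} (h : imps A ⊆ imps B) :
    ∀ J : OuterCtx, imps (J.fill A) ⊆ imps (J.fill B)
  | .hole => h
  | .andL J _ | .orL J _ => Finset.union_subset_union (imps_fill_mono h J) subset_rfl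
  | .andR _ J | .orR _ J => Finset.union_subset_union subset_rfl (imps_fill_mono h J)

theorem connCount_fill_lt {A B : ModalForm} (h : connCount A < connCount B) :
    ∀ J : OuterCtx, connCount (J.fill A) < connCount (J.fill B)
  | .hole => h
  | .andL J _ | .orL J _ | .andR _ J | .orR _ J => by
    have := connCount_fill_lt h J
    simp only [OuterCtx.fill, connCount]
    omega

theorem imps_bigAnd {S : Finset ModalForm} : ∀ {L : List ModalForm},
    (∀ x ∈ L, imps x ⊆ S) → imps (bigAnd L) ⊆ S
  | [], _ => Finset.empty_subset _
  | [A], h => h A (by simp)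
  | A :: _ :: _, h => Finset.union_subset (h A (by simp))
      (imps_bigAnd fun x hx => h x (List.mem_cons_of_mem _ hx))

theorem mem_imps_bigOr {E : ModalForm} : ∀ {L : List ModalForm},
    E ∈ imps (bigOr L) → ∃ x ∈ L, E ∈ imps x
  | [], h => by simp [bigOr, imps] at h
  | [A], h => ⟨A, by simp, h⟩
  | A :: _ :: _, h => by
    rcases Finset.mem_union.1 h with h | h
    · exact ⟨A, by simp, h⟩
    · obtain ⟨x, hx, h⟩ := mem_imps_bigOr h
      exact ⟨x, List.mem_cons_of_mem _ hx, h⟩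

theorem imps_of_mem_conjunctList : ∀ {B x : ModalForm}, x ∈ conjunctList B → imps x ⊆ imps B
  | and _ _, _, hx => (List.mem_append.1 hx).elim
      (fun h => (imps_of_mem_conjunctList h).trans Finset.subset_union_left)
      (fun h => (imps_of_mem_conjunctList h).trans Finset.subset_union_right)
  | .or _ _, _, hx | .atom _, _, hx | .top, _, hx | .bot, _, hx | .imp _ _, _, hx
  | .box _, _, hx => by
    simp only [conjunctList, List.mem_singleton] at hx
    rw [hx]

theorem imps_of_mem_conjuncts {B x : ModalForm} (h : x ∈ conjuncts B) : imps x ⊆ imps B :=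
  imps_of_mem_conjunctList (List.mem_dedup.1 h)

/-! ### Decrease of the connective count -/

/-- The number of connectives of a conjunction of the members of `L`, plus one. -/
def listWeight (L : List ModalForm) : ℕ := (L.map fun x => connCount x + 1).sum

theorem connCount_bigAnd : ∀ {L : List ModalForm}, L ≠ [] → connCount (bigAnd L) + 1 = listWeight L
  | [A], _ => by simp [bigAnd, listWeight]
  | A :: B :: L, _ => by
    have := connCount_bigAnd (List.cons_ne_nil B L)
    simp only [bigAnd, connCount, listWeight, List.map_cons, List.sum_cons] at this ⊢
    omega

theorem listWeight_conjunctList : ∀ B : ModalForm, listWeight (conjunctList B) = connCount B + 1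
  | and A B => by
    have h₁ := listWeight_conjunctList A
    have h₂ := listWeight_conjunctList B
    simp only [listWeight, conjunctList, List.map_append, List.sum_append, connCount] at h₁ h₂ ⊢
    omega
  | .or _ _ | .atom _ | .top | .bot | .imp _ _ | .box _ => by simp [listWeight, conjunctList]

theorem listWeight_conjuncts_le (B : ModalForm) : listWeight (conjuncts B) ≤ connCount B + 1 := by
  rw [← listWeight_conjunctList]
  exact ((List.dedup_sublist _).map _).sum_le_sum fun _ _ => Nat.zero_le _

theorem listWeight_erase {L : List ModalForm} {x : ModalForm} (h : x ∈ L) :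
    listWeight (L.erase x) + (connCount x + 1) = listWeight L := by
  have := ((List.perm_cons_erase h).map fun x => connCount x + 1).sum_eq
  simp only [List.map_cons, List.sum_cons] at this
  simp only [listWeight]
  omega

/-- A `B` without connectives must be excluded: erasing its only conjunct leaves `⊤`, whose count is
also `0`. -/
theorem connCount_erase_lt {B x : ModalForm} (h : x ∈ conjuncts B) (hB : connCount B ≠ 0) :
    connCount (bigAnd ((conjuncts B).erase x)) < connCount B := by
  by_cases hL : (conjuncts B).erase x = []
  · rw [hL]
    exact Nat.pos_of_ne_zero hB
  · have h₁ := connCount_bigAnd hL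
    have h₂ := listWeight_erase h
    have h₃ := listWeight_conjuncts_le B
    omega

theorem connCount_down_lt {B D : ModalForm} (h : D ∈ conjuncts B) (hD : IsImp D) :
    connCount (down (conjuncts B) D) < connCount B := by
  have h₀ : ((conjuncts B).erase D).insert (consequent D) ≠ [] :=
    List.ne_nil_of_mem (mem_down.2 (.inl rfl))
  have h₁ := connCount_bigAnd h₀
  have h₂ := listWeight_erase h
  have h₃ := listWeight_conjuncts_le B
  have h₄ : connCount (consequent D) < connCount D := by
    obtain ⟨E, F, rfl⟩ := hD
    simp only [consequent, connCount]
    omega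
  have h₅ : listWeight (((conjuncts B).erase D).insert (consequent D)) ≤
      listWeight ((conjuncts B).erase D) + (connCount (consequent D) + 1) := by
    rw [List.insert]
    split_ifs
    · exact Nat.le_add_right _ _
    · simp only [listWeight, List.map_cons, List.sum_cons]
      omega
  rw [down]
  omega

/-! ### Decrease of the implication rank -/

theorem contract_of_notMem {E F : ModalForm} : ∀ {A : ModalForm}, imp E F ∉ imps A →
    contract E F A = A
  | .atom _, _ | .top, _ | .bot, _ | .box _, _ => rfl
  | .and A B, h | .or A B, h => by
    simp only [imps, Finset.mem_union, not_or] at h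
    rw [contract, contract_of_notMem h.1, contract_of_notMem h.2]
  | .imp A B, h => by
    simp only [imps, Finset.mem_union, Finset.mem_insert, not_or, imp.injEq] at h
    rw [contract, contract_of_notMem h.2.1, contract_of_notMem h.2.2,
      if_neg fun hc => h.1 ⟨hc.1.symm, hc.2.symm⟩]

theorem imps_subset_image_contract {E F A : ModalForm} {S : Finset ModalForm}
    (h : imp E F ∉ imps A) (hS : imps A ⊆ S) :
    imps A ⊆ (S.erase (imp E F)).image (contract E F) := fun G hG =>
  Finset.mem_image.2 ⟨G, Finset.mem_erase.2 ⟨fun h' => h (h' ▸ hG), hS hG⟩,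
    contract_of_notMem fun h' => h (imps_subset_of_mem hG h')⟩

/-- Implications surviving contraction are contractions of implications other than `E → F`; those
inside `F` are fixed by contraction because they cannot contain `E → F`. -/
theorem imps_contract {E F : ModalForm} {S : Finset ModalForm} : ∀ {A : ModalForm}, imps A ⊆ S →
    imps (contract E F A) ⊆ (S.erase (imp E F)).image (contract E F)
  | .atom _, _ | .top, _ | .bot, _ | .box _, _ => Finset.empty_subset _
  | .and _ _, h | .or _ _, h =>
    Finset.union_subset (imps_contract (Finset.subset_union_left.trans h))
      (imps_contract (Finset.subset_union_right.trans h))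
  | .imp A B, h => by
    rw [imps, Finset.insert_subset_iff, Finset.union_subset_iff] at h
    by_cases hc : A = E ∧ B = F
    · rw [contract, if_pos hc]
      obtain ⟨rfl, rfl⟩ := hc
      exact imps_subset_image_contract imp_notMem_imps_right h.2.2
    · have he : contract E F (imp A B) = imp (contract E F A) (contract E F B) := by
        rw [contract, if_neg hc]
      rw [he, imps, Finset.insert_subset_iff, Finset.union_subset_iff, ← he]
      refine ⟨Finset.mem_image_of_mem _ (Finset.mem_erase.2 ⟨?_, h.1⟩), imps_contract h.2.1,
        imps_contract h.2.2⟩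
      simpa using hc

/-- Apart from the new outer implication, everything in `(B[U → V | V] ∧ U) → V` lies in the image
of `S \ {U → V}`, so at most `(|S| - 1) + 1` implications occur. -/
theorem card_imps_bracketPrime {B : ModalForm} {S : Finset ModalForm} (hB : imps B ⊆ S) :
    ∀ {A : ModalForm}, imps A ⊆ S → ∀ G ∈ imps (bracketPrime B A), (imps G).card ≤ S.card
  | .atom _, _, _, h | .top, _, _, h | .bot, _, _, h | .box _, _, _, h => by
    simp [bracketPrime, imps] at h
  | .and _ _, hA, G, h | .or _ _, hA, G, h => (Finset.mem_union.1 h).elim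
      (card_imps_bracketPrime hB (Finset.subset_union_left.trans hA) G)
      (card_imps_bracketPrime hB (Finset.subset_union_right.trans hA) G)
  | .imp U V, hA, G, h => by
    rw [imps, Finset.insert_subset_iff, Finset.union_subset_iff] at hA
    refine (Finset.card_le_card (imps_subset_of_mem h)).trans ?_
    rw [bracketPrime, imps, imps]
    refine (Finset.card_insert_le _ _).trans ?_
    have hsub := Finset.union_subset (Finset.union_subset (imps_contract (E := U) (F := V) hB)
      (imps_subset_image_contract imp_notMem_imps_left hA.2.1))
      (imps_subset_image_contract imp_notMem_imps_right hA.2.2)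
    have := (Finset.card_le_card hsub).trans Finset.card_image_le
    rw [Finset.card_erase_of_mem hA.1] at this
    have := Finset.card_pos.2 ⟨_, hA.1⟩
    omega

theorem imps_antecedent : ∀ D : ModalForm, imps (antecedent D) ⊆ imps D
  | .imp _ _ => Finset.subset_union_left.trans (Finset.subset_insert _ _)
  | .atom _ | .top | .bot | .box _ | .and _ _ | .or _ _ => subset_rfl

theorem imps_consequent : ∀ D : ModalForm, imps (consequent D) ⊆ imps D
  | .imp _ _ => Finset.subset_union_right.trans (Finset.subset_insert _ _)
  | .atom _ | .top | .bot | .box _ | .and _ _ | .or _ _ => subset_rfl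

theorem complexityLT_bracketPrimeSet {B C : ModalForm} {X : List ModalForm}
    (hX : X = conjuncts B ∨ B = top ∧ X = []) :
    ComplexityLT (bracketPrimeSet B (goalSet X C)) (imp B C) := by
  refine .inl ?_
  rw [impRank_imp, Nat.lt_succ_iff]
  refine Finset.sup_le fun G hG => ?_
  obtain ⟨y, hy, hG⟩ := mem_imps_bigOr hG
  obtain ⟨x, hx, rfl⟩ := List.mem_map.1 hy
  refine card_imps_bracketPrime Finset.subset_union_left ?_ G hG
  rcases mem_goalSet.1 hx with ⟨D, hD, rfl⟩ | rfl
  · rcases hX with rfl | ⟨_, rfl⟩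
    · exact ((imps_antecedent D).trans (imps_of_mem_conjuncts hD)).trans Finset.subset_union_left
    · cases hD
  · exact Finset.subset_union_right

/-! ### Existence of outputs of the NNIL-algorithm -/

theorem exists_star_impImps {B C : ModalForm} {X : List ModalForm}
    (ih : ∀ D, ComplexityLT D (imp B C) → ∃ R, Star D R)
    (hC : ¬ HasOuterAnd C) (hB : ¬ HasOuterOr B) (hX : X = conjuncts B ∨ B = top ∧ X = [])
    (hi : ∀ D ∈ X, IsImp D) : ∃ R, Star (imp B C) R := by
  -- Membership is placed after the existential so that `choose` yields a function on all formulas,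
  -- as the constructors of `Star` expect.
  have hd : ∀ D, ∃ R, D ∈ X → Star (imp (down X D) C) R := by
    intro D
    by_cases hD : D ∈ X
    · rcases hX with rfl | ⟨_, rfl⟩
      · obtain ⟨R, hR⟩ := ih (imp (down (conjuncts B) D) C) <| complexityLT_imp
          (imps_bigAnd fun x hx => by
            rcases mem_down.1 hx with rfl | hx
            · exact (imps_consequent D).trans (imps_of_mem_conjuncts hD)
            · exact imps_of_mem_conjuncts (List.mem_of_mem_erase hx)) subset_rfl
          (Nat.add_lt_add_right (connCount_down_lt hD (hi D hD)) _)
        exact ⟨R, fun _ => hR⟩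
      · cases hD
    · exact ⟨top, fun h => (hD h).elim⟩
  choose f hf using hd
  by_cases hlt : ComplexityLT (bracketSet B (goalSet X C)) (imp B C)
  · obtain ⟨R, hR⟩ := ih _ hlt
    exact ⟨_, .impImps B C X f hC hB hX hi hf hlt hR⟩
  · obtain ⟨R, hR⟩ := ih _ (complexityLT_bracketPrimeSet hX)
    exact ⟨_, .impImpsPrime B C X f hC hB hX hi hf hlt hR⟩

theorem exists_star_imp {B C : ModalForm}
    (ih : ∀ D, ComplexityLT D (imp B C) → ∃ R, Star D R) : ∃ R, Star (imp B C) R := by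
  by_cases hC : HasOuterAnd C
  · obtain ⟨J, D, E, rfl⟩ := hC
    obtain ⟨R₁, h₁⟩ := ih (imp B (J.fill D)) <| complexityLT_imp subset_rfl
      (imps_fill_mono Finset.subset_union_left J) (Nat.add_lt_add_left
        (connCount_fill_lt (by simp only [connCount]; omega) J) _)
    obtain ⟨R₂, h₂⟩ := ih (imp B (J.fill E)) <| complexityLT_imp subset_rfl
      (imps_fill_mono Finset.subset_union_right J) (Nat.add_lt_add_left
        (connCount_fill_lt (by simp only [connCount]; omega) J) _)
    exact ⟨_, .impAnd B J D E h₁ h₂⟩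
  by_cases hB : HasOuterOr B
  · obtain ⟨J, D, E, rfl⟩ := hB
    obtain ⟨R₁, h₁⟩ := ih (imp (J.fill D) C) <| complexityLT_imp
      (imps_fill_mono Finset.subset_union_left J) subset_rfl (Nat.add_lt_add_right
        (connCount_fill_lt (by simp only [connCount]; omega) J) _)
    obtain ⟨R₂, h₂⟩ := ih (imp (J.fill E) C) <| complexityLT_imp
      (imps_fill_mono Finset.subset_union_right J) subset_rfl (Nat.add_lt_add_right
        (connCount_fill_lt (by simp only [connCount]; omega) J) _)
    exact ⟨_, .impOr C J D E h₁ h₂⟩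
  have herase : ∀ x ∈ conjuncts B, connCount B ≠ 0 →
      ∃ R, Star (imp (bigAnd ((conjuncts B).erase x)) C) R := fun x hx h0 =>
    ih _ <| complexityLT_imp
      (imps_bigAnd fun y hy => imps_of_mem_conjuncts (List.mem_of_mem_erase hy)) subset_rfl
      (Nat.add_lt_add_right (connCount_erase_lt hx h0) _)
  by_cases hp : ∃ p ∈ conjuncts B, IsAtomOrBox p
  · obtain ⟨p, hp, hp'⟩ := hp
    -- If `B` is `p` itself, the recursive call `⊤ → C` has the same complexity as `B → C` and
    -- escapes the induction hypothesis. It is unfolded one step further, with `X = ∅`, using that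
    -- the two complexities agree.
    by_cases h0 : connCount B = 0
    · have key : (conjuncts B).erase p = [] ∧ imps B = ∅ := by
        cases B <;> simp_all [conjuncts, conjunctList, connCount, imps]
      obtain ⟨R, hR⟩ : ∃ R, Star (imp top C) R := by
        refine exists_star_impImps (X := []) (fun D hD => ih D ?_) hC
          (by rintro ⟨J, _, _, h⟩; cases J <;> cases h) (.inr ⟨rfl, rfl⟩) (by simp)
        have h₁ : impRank (imp top C) = impRank (imp B C) := by
          rw [impRank_imp, impRank_imp, key.2, imps]
        have h₂ : connCount (imp top C) = connCount (imp B C) := by simp [connCount, h0]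
        rwa [ComplexityLT, ← h₁, ← h₂]
      exact ⟨_, .impAtom B C p hC hB hp hp' (by rwa [key.1])⟩
    · obtain ⟨R, hR⟩ := herase p hp h0
      exact ⟨_, .impAtom B C p hC hB hp hp' hR⟩
  by_cases hT : B = top
  · exact exists_star_impImps ih hC hB (.inr ⟨hT, rfl⟩) (by simp)
  by_cases ht : top ∈ conjuncts B
  · have h0 : connCount B ≠ 0 := by
      cases B <;> simp_all [conjuncts, conjunctList, connCount]
    obtain ⟨R, hR⟩ := herase top ht h0
    exact ⟨_, .impTop B C hC hB ht hT hR⟩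
  by_cases hb : bot ∈ conjuncts B
  · exact ⟨_, .impBot B C hC hB hb⟩
  refine exists_star_impImps ih hC hB (.inl rfl) fun D hD => ?_
  have hl := isLit_of_mem_conjunctList hB (List.mem_dedup.1 hD)
  cases D with
  | atom | box => exact (hp ⟨_, hD, trivial⟩).elim
  | top => exact (ht hD).elim
  | bot => exact (hb hD).elim
  | and | or => exact hl.elim
  | imp => exact isImp_imp _ _

theorem exists_star (A : ModalForm) : ∃ R, Star A R := by
  induction A using complexityLT_wf.induction with
  | _ A ih =>
    cases A with
    | atom n => exact ⟨_, .atom n⟩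
    | top => exact ⟨_, .top⟩
    | bot => exact ⟨_, .bot⟩
    | box A => exact ⟨_, .box A⟩
    | imp B C => exact exists_star_imp ih
    | and B C =>
      obtain ⟨R₁, h₁⟩ := ih B (complexityLT_of_subset Finset.subset_union_left
        (by simp only [connCount]; omega))
      obtain ⟨R₂, h₂⟩ := ih C (complexityLT_of_subset Finset.subset_union_right
        (by simp only [connCount]; omega))
      exact ⟨_, .and h₁ h₂⟩
    | or B C =>
      obtain ⟨R₁, h₁⟩ := ih B (complexityLT_of_subset Finset.subset_union_left
        (by simp only [connCount]; omega))
      obtain ⟨R₂, h₂⟩ := ih C (complexityLT_of_subset Finset.subset_union_right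
        (by simp only [connCount]; omega))
      exact ⟨_, .or h₁ h₂⟩

/-! ### The TNNIL-algorithm -/

theorem sizeOf_lt_of_mem_outerBoxes {A B : ModalForm} (h : B ∈ outerBoxes A) :
    sizeOf B < sizeOf A := by
  induction A with
  | atom | top | bot => exact h.elim
  | and _ _ h₁ h₂ | or _ _ h₁ h₂ | imp _ _ h₁ h₂ =>
    rcases h with h | h
    · have := h₁ h; simp only [and.sizeOf_spec, or.sizeOf_spec, imp.sizeOf_spec]; omega
    · have := h₂ h; simp only [and.sizeOf_spec, or.sizeOf_spec, imp.sizeOf_spec]; omega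
  | box A => rw [Set.mem_singleton_iff.1 h, box.sizeOf_spec]; omega

theorem exists_choice_outerBoxes {A : ModalForm} (h : ∀ B ∈ outerBoxes A, ∃ R, Plus B R) :
    ∃ g : ModalForm → ModalForm, ∀ B ∈ outerBoxes A, Plus B (g B) := by
  classical
  exact ⟨fun B => if hB : B ∈ outerBoxes A then (h B hB).choose else B, fun B hB => by
    simp only [dif_pos hB]; exact (h B hB).choose_spec⟩

theorem exists_plus (A : ModalForm) : ∃ R, Plus A R := by
  obtain ⟨S, hS⟩ := exists_star A
  obtain ⟨g, hg⟩ := exists_choice_outerBoxes (A := A) fun B hB =>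
    have := sizeOf_lt_of_mem_outerBoxes hB
    exists_plus B
  exact ⟨_, .mk A S g hS hg⟩
termination_by sizeOf A

/-- Replacement of the outer boxed subformulas by equivalents. -/
theorem Der.mapBox_iff {T : Set ModalForm} {g : ModalForm → ModalForm} : ∀ {A : ModalForm}
    {Γ : Set ModalForm}, (∀ B ∈ outerBoxes A, IK4With T (iff (ModalForm.box B)
      (ModalForm.box (g B)))) → (Der T Γ A ↔ Der T Γ (mapBox g A))
  | .atom _, _, _ | .top, _, _ | .bot, _, _ => Iff.rfl
  | .box A, _, h => ⟨fun i => (andL (.thm (h A rfl))).mp i, fun i => (andR (.thm (h A rfl))).mp i⟩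
  | .and A B, _, h => by
    rw [mapBox, and_iff, and_iff, mapBox_iff fun C hC => h C (.inl hC),
      mapBox_iff fun C hC => h C (.inr hC)]
  | .or A B, _, h => by
    have hA := fun C hC => h C (.inl hC)
    have hB := fun C hC => h C (.inr hC)
    exact ⟨fun i => orE i (orL ((mapBox_iff hA).1 head)) (orR ((mapBox_iff hB).1 head)),
      fun i => orE i (orL ((mapBox_iff hA).2 head)) (orR ((mapBox_iff hB).2 head))⟩
  | .imp A B, _, h => by
    have hA := fun C hC => h C (.inl hC)
    have hB := fun C hC => h C (.inr hC)
    exact ⟨fun i => impI ((mapBox_iff hB).1 (i.insert.mp ((mapBox_iff hA).2 head))),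
      fun i => impI ((mapBox_iff hB).2 (i.insert.mp ((mapBox_iff hA).1 head)))⟩

theorem Der.iff_intro {T : Set ModalForm} {A B : ModalForm}
    (h : ∀ Γ : Set ModalForm, Der T Γ A ↔ Der T Γ B) : IK4With T (iff A B) :=
  Der.toThm (Der.andI (Der.impI ((h _).1 Der.head)) (Der.impI ((h _).2 Der.head)))

/-! ### Boxed subformulas of box-translations -/

/-- The formulas that occur under a box in some box-translation. -/
inductive BoxTrClosed : ModalForm → Prop
  | atom (n : ℕ) : BoxTrClosed (ModalForm.atom n)
  | boxTr (A : ModalForm) : BoxTrClosed A.boxTr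
  | imp (A B : ModalForm) : BoxTrClosed (ModalForm.imp A.boxTr B.boxTr)

theorem BoxTrClosed.pers {A : ModalForm} (h : BoxTrClosed A) (Γ : Set ModalForm) :
    Pers true Γ A := by
  cases h with
  | atom n => exact .atom _ _
  | boxTr A => exact (pers_boxTr A Γ).1
  | imp A B => exact .imp (pers_boxTr A Γ).2 (pers_boxTr B Γ).1

theorem boxTrClosed_of_mem_boxTr {A B : ModalForm} (h : B ∈ outerBoxes A.boxTr) :
    BoxTrClosed B := by
  induction A with
  | top | bot => exact h.elim
  | atom n =>
    rcases h with h | h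
    · exact h.elim
    · rw [Set.mem_singleton_iff.1 h]; exact .atom n
  | and _ _ h₁ h₂ | or _ _ h₁ h₂ => exact h.elim h₁ h₂
  | imp A C h₁ h₂ =>
    rcases h with h | h
    · exact h.elim h₁ h₂
    · rw [Set.mem_singleton_iff.1 h]; exact .imp A C
  | box A => rw [Set.mem_singleton_iff.1 h]; exact .boxTr A

theorem BoxTrClosed.of_mem {A B : ModalForm} (hA : BoxTrClosed A) (h : B ∈ outerBoxes A) :
    BoxTrClosed B := by
  cases hA with
  | atom n => exact h.elim
  | boxTr A => exact boxTrClosed_of_mem_boxTr h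
  | imp A C => exact h.elim boxTrClosed_of_mem_boxTr boxTrClosed_of_mem_boxTr

/-- `□A → □A^*` is an instance of the preservation axioms, `□A^* → □A` is soundness, and the
induction hypothesis on boxes passes from `A^*` to `A^+` under `□`. -/
theorem iHStarSigma_box_plus {A R : ModalForm} (h : Plus A R) (hA : BoxTrClosed A) :
    IHStarSigma (iff (box A) (box R)) := by
  induction h with
  | mk A S g hS _ ih =>
    have hg : ∀ B ∈ outerBoxes S, IHStarSigma (iff (box B) (box (g B))) := fun B hB =>
      ih B (outerBoxes_star hS hB) (hA.of_mem (outerBoxes_star hS hB))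
    -- At the start nothing has been split off, so `γ = ⊤`.
    have hP : Pres A S := .a2 (.of_der (Der.andI Der.topI Der.self))
      (Pres.of_star hS (hA.pers {top}))
    refine Der.iff_intro fun Γ => ⟨fun i => ?_, fun i => ?_⟩
    · exact Der.box_mono (Der.toImp ((Der.mapBox_iff hg).1 Der.self))
        (Der.mp (.thm (.ax (.inr ⟨A, S, hP, rfl⟩))) i)
    · exact Der.box_mono (Der.toImp (Der.of_star hS ((Der.mapBox_iff hg).2 Der.self))) i

end ModalForm

theorem mainTheorem6 (A : ModalForm) :
    (∃ R : ModalForm, ModalForm.Minus A.boxTr R) ∧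
      ∀ R : ModalForm, ModalForm.Minus A.boxTr R →
        ModalForm.IHStarSigma (ModalForm.iff A.boxTr R) := by
  constructor
  · obtain ⟨g, hg⟩ := ModalForm.exists_choice_outerBoxes (A := A.boxTr) fun B _ =>
      ModalForm.exists_plus B
    exact ⟨_, g, hg, rfl⟩
  · rintro _ ⟨g, hg, rfl⟩
    exact ModalForm.Der.iff_intro fun _ => ModalForm.Der.mapBox_iff fun B hB =>
      ModalForm.iHStarSigma_box_plus (hg B hB) (ModalForm.boxTrClosed_of_mem_boxTr hB)
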